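/- Let $\lambda>0$ and $\gamma,\beta,\rho\in\mathbb R$. Let $Z=(Z_t)_{t\ge0}$ be a real-valued Lévy process independent of the random variable $X_0$, and let $$X_t=X_0-\lambda\int_0^tX_s\,ds+Z_t,\qquad Y_t=\int_0^t(\gamma+\beta X_s)\,ds+\rho Z_t\qquad(t\ge0).$$ Assume that $X$ is strictly stationary and that its stationary distribution $F=\mathcal L(X_0)$ has finite moments of all orders. Put $H_T:=Y_T-E[Y_T]$. For a random variable $\xi$ with law $\mu$ write $$\kappa^{(r)}_\mu:=(-i)^r\,\partial_u^r\log E[e^{iu\xi}]\big|_{u=0}$$ for its $r$-th cumulant, and let $\chi_{r,T}$ be the $r$-th cumulant of $T^{-1/2}H_T$ and $\Sigma_T:=\chi_{2,T}$. Set $\eta(\lambda,u):=\lambda^{-1}(1-e^{-\lambda u})$, $\mathcal M_{r,T}(0):=1$ and $$\mathcal M_{r,T}(j):=\lambda^{-j}-T^{-1}\lambda^{-(j+1)}\sum_{k=1}^{j}k^{-1}\{\lambda\eta(\lambda,T)\}^k,\qquad j\ge1.$$ Then each $Y_T$ has finite moments of all orders, $u\mapsto\log E[e^{iu\xi}]$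 is of class $C^r$ near $0$ for every $r$, both for $\xi\sim F$ and for $\xi=T^{-1/2}H_T$, $T>0$ (so that all these cumulants exist), and the following hold. 1. For all integers $r\ge2$ and all $T>0$, $$\chi_{r,T}=T^{-(r-2)/2}\Big[T^{-1}\{\beta\eta(\lambda,T)\}^r+\lambda r\sum_{j=0}^r\binom rj\rho^{r-j}\beta^j\mathcal M_{r,T}(j)\Big]\kappa^{(r)}_F .$$ 2. For every $r\ge2$, $\chi_{r,T}=O(T^{-(r-2)/2})$ as $T\to\infty$, and $$T^{(r-2)/2}\chi_{r,T}\to\lambda r\sum_{j=0}^r\binom rj\rho^{r-j}\beta^j\lambda^{-j}\,\kappa^{(r)}_F\qquad(T\to\infty).$$ 3. In particular $\Sigma_T\to2\lambda^{-1}(\beta+\rho\lambda)^2\kappa^{(2)}_F$ as $T\to\infty$. 4. If $\beta+\rho\lambda=0$, then $\Sigma_T\to0$ and $T^{-1/2}H_T\to0$ in probability as $T\to\infty$. Consequently the condition $\beta+\rho\lambda\ne0$ is necessary for $T^{-1/2}H_T$ to converge in distribution to a centred Gaussian law $N(0,v)$ with $v>0$. -/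

import Mathlib

open MeasureTheory ProbabilityTheory Filter Topology Asymptotics
open scoped NNReal ENNReal

namespace LevyOU

noncomputable section

/-- `Z` is a real-valued Lévy process under `P`: it starts at `0`, has independent and stationary
increments and almost surely càdlàg paths. (Continuity in probability is a consequence of
right-continuity and stationarity of the increments.) -/
structure IsLevyProcess {Ω : Type*} [MeasurableSpace Ω] (P : Measure Ω)
    (Z : ℝ≥0 → Ω → ℝ) : Prop where
  measurable : ∀ t, Measurable (Z t)
  zero : ∀ᵐ ω ∂P, Z 0 ω = 0
  indepIncrements : HasIndepIncrements Z P
  stationaryIncrements :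
    ∀ s h, IdentDistrib (fun ω => Z (s + h) ω - Z s ω) (Z h) P P
  cadlag : ∀ᵐ ω ∂P, ∀ t : ℝ≥0,
    ContinuousWithinAt (fun s => Z s ω) (Set.Ici t) t ∧
      ∃ l : ℝ, Tendsto (fun s => Z s ω) (𝓝[<] t) (𝓝 l)

/-- Strict stationarity: the law of the whole path is invariant under time shifts. -/
def IsStrictlyStationary {Ω : Type*} [MeasurableSpace Ω] (P : Measure Ω)
    (X : ℝ≥0 → Ω → ℝ) : Prop :=
  ∀ h : ℝ≥0, IdentDistrib (fun ω t => X (h + t) ω) (fun ω t => X t ω) P P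

/-- The bivariate model
`X_t = X_0 - lam ∫₀ᵗ X_s ds + Z_t`, `Y_t = ∫₀ᵗ (gam + bet X_s) ds + rho Z_t`,
where `Z` is a Lévy process independent of `X_0`. -/
structure IsModel {Ω : Type*} [MeasurableSpace Ω] (P : Measure Ω)
    (lam gam bet rho : ℝ) (X Y Z : ℝ≥0 → Ω → ℝ) : Prop where
  levy : IsLevyProcess P Z
  measurable_X : ∀ t, Measurable (X t)
  measurable_Y : ∀ t, Measurable (Y t)
  indep : IndepFun (X 0) (fun ω t => Z t ω) P
  path_integrable : ∀ᵐ ω ∂P, ∀ t : ℝ≥0,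
    IntervalIntegrable (fun s : ℝ => X s.toNNReal ω) volume 0 t
  eq_X : ∀ᵐ ω ∂P, ∀ t : ℝ≥0,
    X t ω = X 0 ω - lam * (∫ s in (0 : ℝ)..t, X s.toNNReal ω) + Z t ω
  eq_Y : ∀ᵐ ω ∂P, ∀ t : ℝ≥0,
    Y t ω = (∫ s in (0 : ℝ)..t, (gam + bet * X s.toNNReal ω)) + rho * Z t ω

/-- The logarithm `u ↦ log E[exp(iuξ)]` of the characteristic function of `ξ ∼ μ`. Only its germ
at `0` is used, where the characteristic function is close to `1`. -/
def logCharFun (μ : Measure ℝ) (u : ℝ) : ℂ := Complex.log (charFun μ u)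

/-- The cumulant of order `r` exists: the logarithm of the characteristic function is of class
`C^r` near `0`. -/
def HasCumulant (r : ℕ) (μ : Measure ℝ) : Prop := ContDiffAt ℝ r (logCharFun μ) 0

/-- The `r`-th cumulant `(-i)^r ∂_u^r log E[exp(iuξ)] |_{u = 0}` of `ξ ∼ μ`. -/
def cumulant (r : ℕ) (μ : Measure ℝ) : ℂ :=
  (-Complex.I) ^ r * iteratedDeriv r (logCharFun μ) 0

/-- `T^{-1/2} H_T`, where `H_T = Y_T - E[Y_T]`. -/
def scaledH {Ω : Type*} [MeasurableSpace Ω] (P : Measure Ω) (Y : ℝ≥0 → Ω → ℝ)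
    (T : ℝ≥0) (ω : Ω) : ℝ :=
  (T : ℝ) ^ (-(1 / 2) : ℝ) * (Y T ω - ∫ ω', Y T ω' ∂P)

/-- `χ_{r,T}`, the `r`-th cumulant of `T^{-1/2} H_T`. -/
def chi {Ω : Type*} [MeasurableSpace Ω] (P : Measure Ω) (Y : ℝ≥0 → Ω → ℝ)
    (r : ℕ) (T : ℝ≥0) : ℂ :=
  cumulant r (P.map (scaledH P Y T))

/-- `η(lam, u) = lam⁻¹ (1 - exp(-lam u))`. -/
def eta (lam u : ℝ) : ℝ := lam⁻¹ * (1 - Real.exp (-(lam * u)))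

/-- The quantities `M_{r,T}(j)` (which do not depend on `r`). -/
def calM (lam T : ℝ) (j : ℕ) : ℝ :=
  if j = 0 then 1
  else (lam ^ j)⁻¹ -
    T⁻¹ * (lam ^ (j + 1))⁻¹ * ∑ k ∈ Finset.Icc 1 j, (k : ℝ)⁻¹ * (lam * eta lam T) ^ k

end

end LevyOU

/-! The integrating factor `exp (lam * t)` solves the equation for `X` path by path and gives `∫₀ᵀ X
= η(T) X₀ + J`, where `J = ∫₀ᵀ exp(-lam (T - s)) Z_s ds` (`integral_solution`). Hence both `X_T` and
`Y_T - gam T` have the form `a X₀ + (b J + c Z_T)`. Summation by parts writes Riemann sums of `b J +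
c Z_T` as sums of independent increments of `Z` with weights `b η(T - t_k) + c`. Cumulants are
additive over independent summands and homogeneous of degree `r`, and in the limit the `r`-th
cumulant is `a^r κ_F + T⁻¹ ∫₀ᵀ (b η(s) + c)^r ds · κ(Z_T)` (`IsModel.cumulant_linear_combination`).
No stochastic integral is needed.

This identity is used twice. For `X_T`, whose law is `F` by stationarity, it is a linear equation
for the cumulant of `Z_T`, with solution `lam r T κ_F` (`IsModel.cumulant_Z`). For `Y_T`, that value
and the closed form of `∫ η^j` give the formula (`IsModel.cumulant_Y`); centring and scaling by
`T^(-1/2)` finish it. The asymptotics are read off from `η(T) → lam⁻¹`.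

The limit passage rests on almost sure convergence with uniform `L^p` bounds, which yields
convergence of moments and then of cumulants (`tendsto_cumulant_map`). The moments of `Z` come from
those of `F`, since `Z_t = X_t - X₀ + lam ∫₀ᵗ X`. -/

namespace LevyOU

/-! ### Cumulants as polynomials in the moments -/

section Cumulants

variable {μ : Measure ℝ} [IsProbabilityMeasure μ]

lemma contDiffAt_logCharFun (hμ : ∀ k : ℕ, MemLp id k μ) (r : ℕ) :
    ContDiffAt ℝ r (logCharFun μ) 0 := by
  have h1 : ContDiffAt ℝ r (charFun μ) 0 := (contDiff_charFun (hμ r)).contDiffAt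
  have h2 : ContDiffAt ℝ r Complex.log (charFun μ 0) :=
    (Complex.contDiffAt_log (by simp)).restrict_scalars ℝ
  exact h2.comp (0 : ℝ) h1

lemma logCharFun_zero : logCharFun μ 0 = 0 := by simp [logCharFun]

lemma eventually_charFun_mem_slitPlane (hμ : ∀ k : ℕ, MemLp id k μ) :
    ∀ᶠ u in 𝓝 (0 : ℝ), charFun μ u ∈ Complex.slitPlane := by
  have hc : ContinuousAt (charFun μ) 0 :=
    ((contDiff_charFun (n := 0) (hμ 0)).continuous).continuousAt
  exact hc.eventually (Complex.isOpen_slitPlane.mem_nhds (by simp))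

lemma deriv_charFun_eventuallyEq (hμ : ∀ k : ℕ, MemLp id k μ) :
    deriv (charFun μ) =ᶠ[𝓝 0] charFun μ * deriv (logCharFun μ) := by
  filter_upwards [eventually_charFun_mem_slitPlane hμ] with u hu
  have hd : DifferentiableAt ℝ (charFun μ) u :=
    ((contDiff_charFun (n := 1) (hμ 1)).differentiable (by simp)).differentiableAt
  have hl := (hd.hasDerivAt.clog_real hu).deriv
  have h0 : charFun μ u ≠ 0 := Complex.slitPlane_ne_zero hu
  rw [Pi.mul_apply]
  change _ = _ * deriv (fun t => Complex.log (charFun μ t)) u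
  rw [hl]
  field_simp

/-- Leibniz's rule applied to `φ' = φ · (log φ)'`, which holds near `0`: the classical recursion
between moments and cumulants. -/
lemma iteratedDeriv_charFun_succ (hμ : ∀ k : ℕ, MemLp id k μ) (r : ℕ) :
    iteratedDeriv (r + 1) (charFun μ) 0 =
      ∑ j ∈ Finset.range (r + 1), (r.choose j : ℂ) * iteratedDeriv j (charFun μ) 0 *
        iteratedDeriv (r - j + 1) (logCharFun μ) 0 := by
  rw [iteratedDeriv_succ', (deriv_charFun_eventuallyEq hμ).iteratedDeriv_eq, iteratedDeriv_mul]
  · simp only [← iteratedDeriv_succ']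
  · exact (contDiff_charFun (hμ r)).contDiffAt
  · exact (contDiffAt_logCharFun hμ (r + 1)).derivWithin (by norm_cast)

/-- Since `φ(0) = 1`, the term `j = 0` of the recursion is the top cumulant itself, so it can be
solved for in terms of moments and lower cumulants. -/
lemma iteratedDeriv_logCharFun_succ (hμ : ∀ k : ℕ, MemLp id k μ) (r : ℕ) :
    iteratedDeriv (r + 1) (logCharFun μ) 0 = iteratedDeriv (r + 1) (charFun μ) 0 -
      ∑ j ∈ Finset.range r, (r.choose (j + 1) : ℂ) * iteratedDeriv (j + 1) (charFun μ) 0 *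
        iteratedDeriv (r - (j + 1) + 1) (logCharFun μ) 0 := by
  rw [iteratedDeriv_charFun_succ hμ r, Finset.sum_range_succ']
  simp

/-- Strong induction along the recursion: each cumulant is a polynomial in finitely many moments,
hence inherits their convergence. -/
lemma tendsto_cumulant {μs : ℕ → Measure ℝ} [∀ n, IsProbabilityMeasure (μs n)]
    (hμs : ∀ n, ∀ k : ℕ, MemLp id k (μs n)) (hμ : ∀ k : ℕ, MemLp id k μ)
    (h : ∀ k : ℕ, Tendsto (fun n => ∫ x, x ^ k ∂μs n) atTop (𝓝 (∫ x, x ^ k ∂μ))) (r : ℕ) :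
    Tendsto (fun n => cumulant r (μs n)) atTop (𝓝 (cumulant r μ)) := by
  refine Tendsto.const_mul _ ?_
  have hφ : ∀ k : ℕ, Tendsto (fun n => iteratedDeriv k (charFun (μs n)) 0) atTop
      (𝓝 (iteratedDeriv k (charFun μ) 0)) := by
    intro k
    simp only [iteratedDeriv_charFun_zero (hμ k), fun n => iteratedDeriv_charFun_zero (hμs n k)]
    exact Tendsto.const_mul _ ((Complex.continuous_ofReal.tendsto _).comp (h k))
  induction r using Nat.strong_induction_on with
  | _ r ih =>
    cases r with
    | zero => simp [logCharFun_zero]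
    | succ r =>
      rw [iteratedDeriv_logCharFun_succ hμ r,
        funext fun n => iteratedDeriv_logCharFun_succ (hμs n) r]
      refine (hφ _).sub (tendsto_finsetSum _ fun j hj => ?_)
      refine ((hφ _).const_mul _).mul (ih _ ?_)
      have := Finset.mem_range.1 hj
      omega

lemma cumulant_two (hμ : ∀ k : ℕ, MemLp id k μ) :
    cumulant 2 μ = ((∫ x, x ^ 2 ∂μ) - (∫ x, x ∂μ) ^ 2 : ℝ) := by
  have h1 : iteratedDeriv 1 (logCharFun μ) 0 = iteratedDeriv 1 (charFun μ) 0 := by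
    simpa using iteratedDeriv_logCharFun_succ hμ 0
  have h2 : iteratedDeriv 2 (logCharFun μ) 0 =
      iteratedDeriv 2 (charFun μ) 0 - iteratedDeriv 1 (charFun μ) 0 ^ 2 := by
    have := iteratedDeriv_logCharFun_succ hμ 1
    simp only [Finset.sum_range_one] at this
    simpa [h1, sq] using this
  rw [cumulant, h2, iteratedDeriv_charFun_zero (hμ 2), iteratedDeriv_charFun_zero (hμ 1)]
  have hI := Complex.I_sq
  push_cast
  simp only [pow_one]
  rw [neg_sq, hI, mul_pow, hI]
  ring

end Cumulants

lemma iteratedDeriv_comp_mul_left (f : ℝ → ℂ) (c : ℝ) (n : ℕ) :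
    iteratedDeriv n (fun u => f (c * u)) = fun u => c ^ n • iteratedDeriv n f (c * u) := by
  induction n with
  | zero => simp
  | succ n ih =>
    rw [iteratedDeriv_succ, ih]
    funext u
    rw [deriv_fun_const_smul_field, deriv_comp_mul_left, iteratedDeriv_succ, smul_smul, pow_succ]

/-! ### Cumulants under sums, scaling and translation -/

section RandomVariables

variable {Ω : Type*} [MeasurableSpace Ω] {P : Measure Ω} [IsProbabilityMeasure P]

omit [IsProbabilityMeasure P] in
lemma memLp_id_map {U : Ω → ℝ} (hm : AEMeasurable U P) (hU : ∀ k : ℕ, MemLp U k P) (k : ℕ) :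
    MemLp id k (P.map U) :=
  (memLp_map_measure_iff aestronglyMeasurable_id hm).2 (hU k)

lemma cumulant_map_add {U V : Ω → ℝ} (hUV : IndepFun U V P)
    (hU : ∀ k : ℕ, MemLp U k P) (hV : ∀ k : ℕ, MemLp V k P) (r : ℕ) :
    cumulant r (P.map (fun ω => U ω + V ω)) = cumulant r (P.map U) + cumulant r (P.map V) := by
  have mU : AEMeasurable U P := (hU 0).1.aemeasurable
  have mV : AEMeasurable V P := (hV 0).1.aemeasurable
  have := Measure.isProbabilityMeasure_map mU
  have := Measure.isProbabilityMeasure_map mV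
  have lU := memLp_id_map mU hU
  have lV := memLp_id_map mV hV
  rw [cumulant, cumulant, cumulant, ← mul_add,
    ← iteratedDeriv_add (contDiffAt_logCharFun lU r) (contDiffAt_logCharFun lV r)]
  congr 1
  refine EventuallyEq.iteratedDeriv_eq r ?_
  -- Positive real parts confine both arguments to `(-π/2, π/2)`; their sum stays in the principal
  -- range, so `Complex.log` turns the product into a sum.
  have hre : ∀ {W : Ω → ℝ}, AEMeasurable W P → (∀ k : ℕ, MemLp id k (P.map W)) →
      ∀ᶠ u in 𝓝 (0 : ℝ), 0 < (charFun (P.map W) u).re := by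
    intro W mW hW
    have := Measure.isProbabilityMeasure_map mW
    have hc : Continuous (fun u => (charFun (P.map W) u).re) :=
      Complex.continuous_re.comp (contDiff_charFun (n := 0) (hW 0)).continuous
    exact hc.continuousAt.eventually (lt_mem_nhds (by simp))
  filter_upwards [hre mU lU, hre mV lV] with u h1 h2
  have h0 : ∀ {z : ℂ}, 0 < z.re → z ≠ 0 := by rintro z hz rfl; simp at hz
  have a1 := Complex.abs_arg_lt_pi_div_two_iff.2 (Or.inl h1)
  have a2 := Complex.abs_arg_lt_pi_div_two_iff.2 (Or.inl h2)
  rw [abs_lt] at a1 a2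
  rw [Pi.add_apply, logCharFun, hUV.charFun_map_fun_add_eq_mul mU mV, Pi.mul_apply,
    Complex.log_mul (h0 h1) (h0 h2) ⟨by linarith, by linarith⟩, logCharFun, logCharFun]

lemma cumulant_map_const_mul {U : Ω → ℝ} (hU : ∀ k : ℕ, MemLp U k P) (c : ℝ) (r : ℕ) :
    cumulant r (P.map (fun ω => c * U ω)) = (c : ℂ) ^ r * cumulant r (P.map U) := by
  have mU : AEMeasurable U P := (hU 0).1.aemeasurable
  have := Measure.isProbabilityMeasure_map mU
  have lU := memLp_id_map mU hU
  have h : logCharFun (P.map (fun ω => c * U ω)) = fun u => logCharFun (P.map U) (c * u) := by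
    funext u
    rw [logCharFun, charFun_map_mul_comp mU, logCharFun]
  rw [cumulant, cumulant, h, iteratedDeriv_comp_mul_left]
  simp only [mul_zero, Complex.real_smul, Complex.ofReal_pow]
  ring

/-- A constant is independent of everything, and its log-characteristic function is linear as long
as `u * c` stays in the principal strip; derivatives of order at least two vanish. -/
lemma cumulant_map_add_const {U : Ω → ℝ} (hU : ∀ k : ℕ, MemLp U k P) (c : ℝ) {r : ℕ}
    (hr : 2 ≤ r) :
    cumulant r (P.map (fun ω => U ω + c)) = cumulant r (P.map U) := by
  rw [cumulant_map_add (V := fun _ => c) (indepFun_const_right U c) hU (fun k => memLp_const c)]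
  rw [add_eq_left, Measure.map_const, measure_univ, one_smul, cumulant]
  have h : logCharFun (Measure.dirac c) =ᶠ[𝓝 0] fun u => (u : ℂ) * (c * Complex.I) := by
    have hc : Continuous fun u : ℝ => u * c := by fun_prop
    have h1 : ∀ᶠ u : ℝ in 𝓝 0, u * c < Real.pi :=
      hc.continuousAt.eventually (gt_mem_nhds (by simp [Real.pi_pos]))
    have h2 : ∀ᶠ u : ℝ in 𝓝 0, -Real.pi < u * c :=
      hc.continuousAt.eventually (lt_mem_nhds (by simp [Real.pi_pos]))
    filter_upwards [h1, h2] with u h1 h2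
    rw [logCharFun, charFun_dirac, Complex.log_exp]
    · simp; ring
    · simpa [mul_comm] using h2
    · simpa [mul_comm] using h1.le
  rw [h.iteratedDeriv_eq]
  obtain ⟨r, rfl⟩ := Nat.exists_eq_add_of_le hr
  have : iteratedDeriv (2 + r) (fun u : ℝ => (u : ℂ) * (c * Complex.I)) = 0 := by
    rw [add_comm, iteratedDeriv_succ', iteratedDeriv_succ']
    have : deriv (fun u : ℝ => (u : ℂ) * (c * Complex.I)) = fun _ => (c * Complex.I) := by
      funext u
      simpa using ((Complex.ofRealCLM.hasDerivAt (x := u)).mul_const (c * Complex.I)).deriv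
    rw [this]
    ext u
    simp
  rw [this]; simp

end RandomVariables

/-! ### Convergence of moments and cumulants from uniform `L^p` bounds -/

section Moments

variable {Ω : Type*} [MeasurableSpace Ω] {P : Measure Ω}

lemma unifIntegrable_one_of_eLpNorm_two_le {g : ℕ → Ω → ℝ} {C : ℝ≥0}
    (hg : ∀ n, AEStronglyMeasurable (g n) P) (hC : ∀ n, eLpNorm (g n) 2 P ≤ C) :
    UnifIntegrable g 1 P := by
  intro ε hε
  -- Hölder bounds the `L¹` norm on `s` by `C · P(s)^(1/2)`, hence the square; the `+ 1` covers `C =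
  -- 0`.
  refine ⟨(ε / (C + 1)) ^ 2, by positivity, fun n s hs hPs => ?_⟩
  rw [eLpNorm_indicator_eq_eLpNorm_restrict hs]
  calc eLpNorm (g n) 1 (P.restrict s)
      ≤ eLpNorm (g n) 2 (P.restrict s) *
          (P.restrict s) Set.univ ^ (1 / (1 : ℝ≥0∞).toReal - 1 / (2 : ℝ≥0∞).toReal) :=
        eLpNorm_le_eLpNorm_mul_rpow_measure_univ (by norm_num) (hg n).restrict
    _ ≤ C * ENNReal.ofReal (ε / (C + 1)) := by
        gcongr
        · exact (eLpNorm_restrict_le _ _ _ _).trans (hC n)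
        · rw [Measure.restrict_apply_univ]
          calc P s ^ (1 / (1 : ℝ≥0∞).toReal - 1 / (2 : ℝ≥0∞).toReal)
              ≤ ENNReal.ofReal ((ε / (C + 1)) ^ 2) ^ (1 / 2 : ℝ) := by
                have : (1 / (1 : ℝ≥0∞).toReal - 1 / (2 : ℝ≥0∞).toReal) = 1 / 2 := by norm_num
                rw [this]
                gcongr
            _ = ENNReal.ofReal (ε / (C + 1)) := by
                rw [ENNReal.ofReal_rpow_of_nonneg (by positivity) (by norm_num),
                  ← Real.sqrt_eq_rpow, Real.sqrt_sq (by positivity)]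
    _ ≤ ENNReal.ofReal ε := by
        rw [← ENNReal.ofReal_coe_nnreal, ← ENNReal.ofReal_mul (by positivity)]
        refine ENNReal.ofReal_le_ofReal ?_
        have hC0 : (0 : ℝ) ≤ C := C.2
        rw [mul_div_assoc', div_le_iff₀ (by positivity)]
        nlinarith

lemma eLpNorm_pow_two_le {f : Ω → ℝ} {C : ℝ≥0} {k : ℕ} (hk : k ≠ 0)
    (hC : eLpNorm f (2 * k : ℕ) P ≤ C) :
    eLpNorm (fun ω => f ω ^ k) 2 P ≤ (C ^ k : ℝ≥0) := by
  have h1 : eLpNorm (fun ω => f ω ^ k) 2 P = eLpNorm (fun ω => ‖f ω‖ ^ (k : ℝ)) 2 P := by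
    rw [← eLpNorm_norm]
    simp
  have hk' : (0 : ℝ) < k := by exact_mod_cast Nat.pos_of_ne_zero hk
  have h2 : (2 : ℝ≥0∞) * ENNReal.ofReal k = (2 * k : ℕ) := by simp
  rw [h1, eLpNorm_norm_rpow f hk', h2, ENNReal.rpow_natCast, ENNReal.coe_pow]
  gcongr

lemma memLp_of_ae_tendsto {f : ℕ → Ω → ℝ} {g : Ω → ℝ}
    (hf : ∀ n, AEStronglyMeasurable (f n) P)
    (hb : ∀ p : ℕ, ∃ C : ℝ≥0, ∀ n, eLpNorm (f n) p P ≤ C)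
    (hfg : ∀ᵐ ω ∂P, Tendsto (fun n => f n ω) atTop (𝓝 (g ω))) (p : ℕ) : MemLp g p P := by
  obtain ⟨C, hC⟩ := hb p
  exact ⟨aestronglyMeasurable_of_tendsto_ae atTop hf hfg,
    (Lp.eLpNorm_le_of_ae_tendsto (Eventually.of_forall hC) hf hfg).trans_lt ENNReal.coe_lt_top⟩

variable [IsProbabilityMeasure P]

/-- The bound in `L^{2k}` bounds the `k`-th powers in `L²`, which makes them uniformly integrable;
Vitali's theorem then gives `L¹` convergence. -/
lemma tendsto_integral_pow {f : ℕ → Ω → ℝ} {g : Ω → ℝ}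
    (hf : ∀ n, AEStronglyMeasurable (f n) P)
    (hb : ∀ p : ℕ, ∃ C : ℝ≥0, ∀ n, eLpNorm (f n) p P ≤ C)
    (hfg : ∀ᵐ ω ∂P, Tendsto (fun n => f n ω) atTop (𝓝 (g ω))) (k : ℕ) :
    Tendsto (fun n => ∫ ω, f n ω ^ k ∂P) atTop (𝓝 (∫ ω, g ω ^ k ∂P)) := by
  rcases eq_or_ne k 0 with rfl | hk
  · simp
  obtain ⟨C, hC⟩ := hb (2 * k)
  have hm : ∀ n, AEStronglyMeasurable (fun ω => f n ω ^ k) P := fun n => (hf n).pow k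
  have h2 : ∀ n, eLpNorm (fun ω => f n ω ^ k) 2 P ≤ (C ^ k : ℝ≥0) :=
    fun n => eLpNorm_pow_two_le hk (hC n)
  have hlim : ∀ᵐ ω ∂P, Tendsto (fun n => f n ω ^ k) atTop (𝓝 (g ω ^ k)) := by
    filter_upwards [hfg] with ω h using h.pow k
  have hg2 : MemLp (fun ω => g ω ^ k) 2 P :=
    ⟨aestronglyMeasurable_of_tendsto_ae atTop hm hlim,
      (Lp.eLpNorm_le_of_ae_tendsto (Eventually.of_forall h2) hm hlim).trans_lt
        ENNReal.coe_lt_top⟩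
  have hf2 : ∀ n, MemLp (fun ω => f n ω ^ k) 2 P :=
    fun n => ⟨hm n, (h2 n).trans_lt ENNReal.coe_lt_top⟩
  refine tendsto_integral_of_L1' _ (hg2.1)
    (Eventually.of_forall fun n => (hf2 n).integrable (by norm_num)) ?_
  exact tendsto_Lp_finite_of_tendsto_ae le_rfl ENNReal.one_ne_top hm
    (hg2.mono_exponent (by norm_num)) (unifIntegrable_one_of_eLpNorm_two_le hm h2) hlim

lemma tendsto_cumulant_map {f : ℕ → Ω → ℝ} {g : Ω → ℝ}
    (hf : ∀ n, AEStronglyMeasurable (f n) P)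
    (hb : ∀ p : ℕ, ∃ C : ℝ≥0, ∀ n, eLpNorm (f n) p P ≤ C)
    (hfg : ∀ᵐ ω ∂P, Tendsto (fun n => f n ω) atTop (𝓝 (g ω))) (r : ℕ) :
    Tendsto (fun n => cumulant r (P.map (f n))) atTop (𝓝 (cumulant r (P.map g))) := by
  have hgL := memLp_of_ae_tendsto hf hb hfg
  have hfL : ∀ n, ∀ p : ℕ, MemLp (f n) p P := fun n p => by
    obtain ⟨C, hC⟩ := hb p
    exact ⟨hf n, (hC n).trans_lt ENNReal.coe_lt_top⟩
  have mf := fun n => (hf n).aemeasurable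
  have mg : AEMeasurable g P := (hgL 0).1.aemeasurable
  have := fun n => Measure.isProbabilityMeasure_map (mf n)
  have := Measure.isProbabilityMeasure_map mg
  refine tendsto_cumulant (fun n => memLp_id_map (mf n) (hfL n)) (memLp_id_map mg hgL) ?_ r
  intro k
  have hmap : ∀ {h : Ω → ℝ}, AEMeasurable h P → ∫ x, x ^ k ∂P.map h = ∫ ω, h ω ^ k ∂P :=
    fun mh => integral_map mh (by fun_prop)
  simp only [hmap mg, fun n => hmap (mf n)]
  exact tendsto_integral_pow hf hb hfg k

end Moments

/-! ### Càdlàg paths and Riemann sums -/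

section Paths

/-- Right-continuity with left limits. -/
def Cadlag (f : ℝ≥0 → ℝ) : Prop :=
  ∀ t : ℝ≥0, ContinuousWithinAt f (Set.Ici t) t ∧ ∃ l : ℝ, Tendsto f (𝓝[<] t) (𝓝 l)

/-- One-sided limits bound `f` near each point, and compactness patches the local bounds together.
-/
lemma Cadlag.exists_bound {f : ℝ≥0 → ℝ} (hf : Cadlag f) (T : ℝ≥0) :
    ∃ C : ℝ, ∀ s ∈ Set.Icc 0 T, |f s| ≤ C := by
  refine IsCompact.induction_on (p := fun A => ∃ C : ℝ, ∀ s ∈ A, |f s| ≤ C)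
    (isCompact_Icc (a := (0 : ℝ≥0)) (b := T)) ⟨0, by simp⟩ ?_ ?_ ?_
  · rintro A B hAB ⟨C, hC⟩
    exact ⟨C, fun s hs => hC s (hAB hs)⟩
  · rintro A B ⟨C, hC⟩ ⟨D, hD⟩
    refine ⟨max C D, ?_⟩
    rintro s (hs | hs)
    · exact (hC s hs).trans (le_max_left _ _)
    · exact (hD s hs).trans (le_max_right _ _)
  · intro t _
    obtain ⟨hr, l, hl⟩ := hf t
    have h1 : ∀ᶠ s in 𝓝[<] t, |f s| ≤ |l| + 1 :=
      (hl.abs.eventually (gt_mem_nhds (lt_add_one _))).mono fun _ h => h.le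
    have h2 : ∀ᶠ s in 𝓝[≥] t, |f s| ≤ |f t| + 1 :=
      ((hr.tendsto.abs).eventually (gt_mem_nhds (lt_add_one _))).mono fun _ h => h.le
    have h3 : ∀ᶠ s in 𝓝 t, |f s| ≤ max (|l| + 1) (|f t| + 1) := by
      rw [← nhdsLT_sup_nhdsGE, eventually_sup]
      exact ⟨h1.mono fun _ h => h.trans (le_max_left _ _),
        h2.mono fun _ h => h.trans (le_max_right _ _)⟩
    exact ⟨_, mem_nhdsWithin_of_mem_nhds h3, _, fun s hs => hs⟩

/-- The points of the uniform grid of `[0, T]` with `n + 1` cells. -/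
noncomputable def grid (T : ℝ≥0) (n k : ℕ) : ℝ≥0 := k * (T / (n + 1))

lemma grid_zero (T : ℝ≥0) (n : ℕ) : grid T n 0 = 0 := by simp [grid]

lemma grid_last (T : ℝ≥0) (n : ℕ) : grid T n (n + 1) = T := by
  rw [grid]; push_cast; field_simp

lemma grid_mono (T : ℝ≥0) (n : ℕ) : Monotone (grid T n) := by
  intro a b hab
  unfold grid
  gcongr

lemma grid_succ (T : ℝ≥0) (n k : ℕ) : grid T n (k + 1) = grid T n k + T / (n + 1) := by
  unfold grid; push_cast; ring

/-- The smallest grid point above `s`. -/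
noncomputable def gridCeil (T : ℝ≥0) (n : ℕ) (s : ℝ) : ℝ≥0 :=
  grid T n ⌈s.toNNReal / (T / (n + 1))⌉₊

lemma le_gridCeil {T : ℝ≥0} (hT : 0 < T) (n : ℕ) (s : ℝ) : s.toNNReal ≤ gridCeil T n s := by
  have h : 0 < T / (n + 1) := by positivity
  exact (div_le_iff₀ h).1 (Nat.le_ceil _)

lemma gridCeil_le {T : ℝ≥0} (hT : 0 < T) (n : ℕ) (s : ℝ) :
    gridCeil T n s ≤ s.toNNReal + T / (n + 1) := by
  have h : 0 < T / (n + 1) := by positivity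
  have h1 := (Nat.ceil_lt_add_one (zero_le : 0 ≤ s.toNNReal / (T / (n + 1)))).le
  calc gridCeil T n s ≤ (s.toNNReal / (T / (n + 1)) + 1) * (T / (n + 1)) := by
        unfold gridCeil grid; gcongr
    _ = _ := by rw [add_mul, div_mul_cancel₀ _ h.ne', one_mul]

lemma gridCeil_eq {T : ℝ≥0} (hT : 0 < T) (n k : ℕ) {s : ℝ}
    (hs : s ∈ Set.Ioc (grid T n k : ℝ) (grid T n (k + 1))) :
    gridCeil T n s = grid T n (k + 1) := by
  have h : 0 < T / (n + 1) := by positivity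
  have h1 : grid T n k < s.toNNReal := by
    rw [Real.lt_toNNReal_iff_coe_lt]; exact hs.1
  have h2 : s.toNNReal ≤ grid T n (k + 1) := Real.toNNReal_le_iff_le_coe.2 hs.2
  unfold gridCeil
  congr 1
  refine (Nat.ceil_eq_iff (by omega)).2 ⟨?_, ?_⟩
  · rw [lt_div_iff₀ h]; simpa [grid] using h1
  · rw [div_le_iff₀ h]; simpa [grid] using h2

lemma gridCeil_mem {T : ℝ≥0} (hT : 0 < T) (n : ℕ) {s : ℝ} (hs : s ≤ T) :
    gridCeil T n s ≤ T := by
  have h : 0 < T / (n + 1) := by positivity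
  calc gridCeil T n s ≤ grid T n (n + 1) := by
        refine grid_mono T n (Nat.ceil_le.2 ?_)
        rw [div_le_iff₀ h]
        have := grid_last T n
        rw [grid] at this
        rw [this]
        exact Real.toNNReal_le_iff_le_coe.2 hs
    _ = T := grid_last T n

lemma tendsto_gridCeil {T : ℝ≥0} (hT : 0 < T) (s : ℝ) :
    Tendsto (fun n => gridCeil T n s) atTop (𝓝[≥] s.toNNReal) := by
  refine tendsto_nhdsWithin_iff.2 ⟨?_, Eventually.of_forall fun n => le_gridCeil hT n s⟩
  refine tendsto_of_tendsto_of_tendsto_of_le_of_le tendsto_const_nhds ?_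
    (fun n => le_gridCeil hT n s) (fun n => gridCeil_le hT n s)
  have : Tendsto (fun n : ℕ => T * (1 / ((n : ℝ≥0) + 1))) atTop (𝓝 (T * 0)) :=
    tendsto_one_div_add_atTop_nhds_zero_nat.const_mul T
  simpa [div_eq_mul_inv] using this.const_add s.toNNReal

/-- Sampling at right endpoints approaches each `s` from the right, so right-continuity suffices for
pointwise convergence, and boundedness of the path for domination. The weight is integrated exactly
over each cell, which keeps the later summation by parts free of error terms. -/
lemma Cadlag.tendsto_sum_grid {f : ℝ≥0 → ℝ} (hf : Cadlag f) {w : ℝ → ℝ} (hw : Continuous w)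
    {T : ℝ≥0} (hT : 0 < T) :
    Tendsto (fun n : ℕ => ∑ k ∈ Finset.range (n + 1),
        (∫ s in (grid T n k : ℝ)..grid T n (k + 1), w s) * f (grid T n (k + 1))) atTop
      (𝓝 (∫ s in (0 : ℝ)..T, w s * f s.toNNReal)) := by
  have hcell : ∀ n k : ℕ, Set.EqOn (fun s => w s * f (grid T n (k + 1)))
      (fun s => w s * f (gridCeil T n s)) (Set.uIoc (grid T n k : ℝ) (grid T n (k + 1))) := by
    intro n k s hs
    rw [Set.uIoc_of_le (NNReal.coe_le_coe.2 (grid_mono T n k.le_succ))] at hs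
    simp only [gridCeil_eq hT n k hs]
  have hint : ∀ n k : ℕ, IntervalIntegrable (fun s => w s * f (gridCeil T n s)) volume
      (grid T n k : ℝ) (grid T n (k + 1)) := fun n k =>
    ((hw.mul continuous_const).intervalIntegrable _ _).congr (hcell n k)
  have hsum : ∀ n : ℕ, ∑ k ∈ Finset.range (n + 1),
      (∫ s in (grid T n k : ℝ)..grid T n (k + 1), w s) * f (grid T n (k + 1)) =
      ∫ s in (0 : ℝ)..T, w s * f (gridCeil T n s) := by
    intro n
    have := intervalIntegral.sum_integral_adjacent_intervals (μ := volume)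
      (f := fun s => w s * f (gridCeil T n s)) (a := fun k => (grid T n k : ℝ)) (n := n + 1)
      (fun k _ => hint n k)
    rw [grid_zero, grid_last] at this
    rw [NNReal.coe_zero] at this
    rw [← this]
    refine Finset.sum_congr rfl fun k _ => ?_
    rw [← intervalIntegral.integral_mul_const]
    exact intervalIntegral.integral_congr_ae (Eventually.of_forall fun s hs => hcell n k hs)
  simp only [hsum]
  obtain ⟨C, hC⟩ := hf.exists_bound T
  refine intervalIntegral.tendsto_integral_filter_of_dominated_convergence
    (fun s => |w s| * C) (Eventually.of_forall fun n => ?_) (Eventually.of_forall fun n => ?_)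
    ((hw.abs.mul continuous_const).intervalIntegrable _ _) ?_
  · have := IntervalIntegrable.trans_iterate (a := fun k => (grid T n k : ℝ)) (n := n + 1)
      (fun k _ => hint n k)
    rw [grid_zero, grid_last] at this
    exact (intervalIntegrable_iff.1 this).aestronglyMeasurable
  · refine Eventually.of_forall fun s hs => ?_
    rw [Set.uIoc_of_le T.coe_nonneg] at hs
    rw [Real.norm_eq_abs, abs_mul]
    gcongr
    exact hC _ ⟨zero_le, gridCeil_mem hT n hs.2⟩
  · refine Eventually.of_forall fun s _ => Tendsto.const_mul _ ?_
    exact (hf s.toNNReal).1.tendsto.comp (tendsto_gridCeil hT s)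

end Paths

/-! ### Pathwise solution of the linear equation -/

section LinearEquation

variable {lam : ℝ} {x z : ℝ≥0 → ℝ}

lemma continuous_primitive_path
    (hx : ∀ t : ℝ≥0, IntervalIntegrable (fun s : ℝ => x s.toNNReal) volume 0 t) :
    Continuous fun t : ℝ≥0 => ∫ s in (0 : ℝ)..t, x s.toNNReal := by
  have hint : ∀ a b : ℝ, IntervalIntegrable (fun s : ℝ => x s.toNNReal) volume a b := by
    have h0 : ∀ a : ℝ, IntervalIntegrable (fun s : ℝ => x s.toNNReal) volume 0 a := by
      intro a
      rcases le_total 0 a with ha | ha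
      · exact hx ⟨a, ha⟩
      -- At negative times `toNNReal` clamps to `0`, so the integrand is constant there.
      · refine (intervalIntegrable_const (c := x 0)).congr fun s hs => ?_
        rw [Set.uIoc_of_ge ha] at hs
        simp [Real.toNNReal_of_nonpos hs.2]
    exact fun a b => (h0 a).symm.trans (h0 b)
  exact (intervalIntegral.continuous_primitive hint 0).comp NNReal.continuous_coe

lemma cadlag_solution (hz : Cadlag z)
    (hx : ∀ t : ℝ≥0, IntervalIntegrable (fun s : ℝ => x s.toNNReal) volume 0 t)
    (heq : ∀ t : ℝ≥0, x t = x 0 - lam * (∫ s in (0 : ℝ)..t, x s.toNNReal) + z t) :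
    Cadlag x := by
  have hc : Continuous fun t : ℝ≥0 => x 0 - lam * (∫ s in (0 : ℝ)..t, x s.toNNReal) :=
    continuous_const.sub (continuous_const.mul (continuous_primitive_path hx))
  have hfun : x = fun t : ℝ≥0 =>
      (x 0 - lam * (∫ s in (0 : ℝ)..t, x s.toNNReal)) + z t := funext heq
  intro t
  rw [hfun]
  obtain ⟨h1, l, h2⟩ := hz t
  exact ⟨hc.continuousWithinAt.add h1, _, ((hc.tendsto t).mono_left nhdsWithin_le_nhds).add h2⟩

lemma integral_exp_eq_eta (hlam : 0 < lam) (T : ℝ) (s : ℝ) :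
    ∫ u in s..T, Real.exp (-(lam * (T - u))) = eta lam (T - s) := by
  have : ∀ u ∈ Set.uIcc s T, HasDerivAt (fun u => lam⁻¹ * Real.exp (-(lam * (T - u))))
      (Real.exp (-(lam * (T - u)))) u := by
    intro u _
    have h1 : HasDerivAt (fun u => -(lam * (T - u))) lam u := by
      simpa using (((hasDerivAt_id u).const_sub T).const_mul lam).fun_neg
    have h2 := (h1.exp).const_mul lam⁻¹
    refine h2.congr_deriv ?_
    rw [mul_comm (Real.exp _), inv_mul_cancel_left₀ hlam.ne']
  rw [intervalIntegral.integral_eq_sub_of_hasDerivAt this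
    ((by fun_prop : Continuous fun u => Real.exp (-(lam * (T - u)))).intervalIntegrable _ _)]
  simp [eta]
  ring

/-- With `I` the primitive of `x`, the equation reads `I' + lam I = x 0 + z`, so `(exp(lam t) I)' =
exp(lam t) (x 0 + z)`. As `x` is only càdlàg, this is a right derivative, and the fundamental
theorem is used in its one-sided form. -/
lemma integral_solution (hlam : 0 < lam) (hz : Cadlag z)
    (hx : ∀ t : ℝ≥0, IntervalIntegrable (fun s : ℝ => x s.toNNReal) volume 0 t)
    (heq : ∀ t : ℝ≥0, x t = x 0 - lam * (∫ s in (0 : ℝ)..t, x s.toNNReal) + z t) (T : ℝ≥0) :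
    ∫ s in (0 : ℝ)..T, x s.toNNReal =
      eta lam T * x 0 + ∫ s in (0 : ℝ)..T, Real.exp (-(lam * (T - s))) * z s.toNNReal := by
  set I : ℝ → ℝ := fun t => ∫ s in (0 : ℝ)..t, x s.toNNReal with hI
  have hxc := cadlag_solution hz hx heq
  have hIc : ContinuousOn I (Set.uIcc 0 T) :=
    intervalIntegral.continuousOn_primitive_interval' (hx T) Set.left_mem_uIcc
  have hzx : ∀ s ∈ Set.uIcc (0 : ℝ) T, z s.toNNReal = x s.toNNReal - x 0 + lam * I s := by
    intro s hs
    rw [Set.uIcc_of_le T.coe_nonneg] at hs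
    have := heq s.toNNReal
    rw [Real.coe_toNNReal _ hs.1] at this
    rw [this, hI]; ring
  have hzint : IntervalIntegrable (fun s : ℝ => z s.toNNReal) volume 0 T := by
    refine IntervalIntegrable.congr (f := fun s : ℝ => x s.toNNReal - x 0 + lam * I s) ?_ ?_
    · intro s hs
      exact (hzx s (Set.uIoc_subset_uIcc hs)).symm
    · exact ((hx T).sub intervalIntegrable_const).add
        ((continuousOn_const.mul hIc).intervalIntegrable)
  have hderiv : ∀ t ∈ Set.Ioo (0 : ℝ) T, HasDerivWithinAt (fun t => Real.exp (lam * t) * I t)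
      (Real.exp (lam * t) * (x 0 + z t.toNNReal)) (Set.Ioi t) t := by
    intro t ht
    have hrc : ContinuousWithinAt (fun s : ℝ => x s.toNNReal) (Set.Ici t) t := by
      refine (hxc t.toNNReal).1.comp continuous_real_toNNReal.continuousWithinAt ?_
      intro s hs
      exact Real.toNNReal_le_toNNReal hs
    have htT : IntervalIntegrable (fun s : ℝ => x s.toNNReal) volume 0 t := by
      exact (hx T).mono_set
        (Set.uIcc_subset_uIcc Set.left_mem_uIcc (Set.mem_uIcc_of_le ht.1.le ht.2.le))
    have hmeas : StronglyMeasurableAtFilter (fun s : ℝ => x s.toNNReal) (𝓝[>] t) volume := by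
      refine ⟨Set.Ioc t T, Ioc_mem_nhdsGT ht.2, ?_⟩
      refine (hx T).aestronglyMeasurable.mono_measure (Measure.restrict_mono ?_ le_rfl)
      exact Set.Ioc_subset_Ioc_left ht.1.le
    have h1 : HasDerivWithinAt I (x t.toNNReal) (Set.Ici t) t :=
      intervalIntegral.integral_hasDerivWithinAt_right htT hmeas
        (hrc.mono Set.Ioi_subset_Ici_self)
    have h2 : HasDerivAt (fun t : ℝ => Real.exp (lam * t)) (Real.exp (lam * t) * lam) t := by
      simpa using ((hasDerivAt_id t).const_mul lam).exp
    refine ((h2.hasDerivWithinAt.mul h1).mono Set.Ioi_subset_Ici_self).congr_deriv ?_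
    rw [hzx t (by rw [Set.uIcc_of_le T.coe_nonneg]; exact ⟨ht.1.le, ht.2.le⟩)]
    ring
  have hftc := intervalIntegral.integral_eq_sub_of_hasDeriv_right
    (a := 0) (b := (T : ℝ)) (f := fun t => Real.exp (lam * t) * I t)
    (f' := fun t => Real.exp (lam * t) * (x 0 + z t.toNNReal))
    ((by fun_prop : Continuous fun t : ℝ => Real.exp (lam * t)).continuousOn.mul hIc)
    (by simpa using hderiv)
    ((intervalIntegrable_const.add hzint).continuousOn_mul
      (by fun_prop : Continuous fun t : ℝ => Real.exp (lam * t)).continuousOn)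
  have hI0 : I 0 = 0 := by simp [hI]
  rw [hI0, mul_zero, sub_zero] at hftc
  have hfin : I T = ∫ s in (0 : ℝ)..T, Real.exp (-(lam * T)) *
      (Real.exp (lam * s) * (x 0 + z s.toNNReal)) := by
    rw [intervalIntegral.integral_const_mul, hftc, ← mul_assoc, ← Real.exp_add]
    simp
  have hsplit : ∀ s : ℝ, Real.exp (-(lam * T)) * (Real.exp (lam * s) * (x 0 + z s.toNNReal)) =
      Real.exp (-(lam * (T - s))) * x 0 + Real.exp (-(lam * (T - s))) * z s.toNNReal := by
    intro s
    rw [← mul_assoc, ← Real.exp_add, mul_add]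
    ring_nf
  have hec : Continuous fun s : ℝ => Real.exp (-(lam * (T - s))) := by fun_prop
  change I T = _
  rw [hfin]
  simp only [hsplit]
  rw [intervalIntegral.integral_add
    ((by fun_prop : Continuous fun s : ℝ => Real.exp (-(lam * (T - s))) * x 0).intervalIntegrable
      _ _)
    (hzint.continuousOn_mul hec.continuousOn), intervalIntegral.integral_mul_const,
    integral_exp_eq_eta hlam, sub_zero]

end LinearEquation

variable {Ω : Type*} [MeasurableSpace Ω] {P : Measure Ω}

lemma eLpNorm_weighted_sum_le {ι : Type*} {s : Finset ι} {c : ι → ℝ} {V : ι → Ω → ℝ} {p C : ℝ≥0∞}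
    (hp : 1 ≤ p) (hc : ∀ i ∈ s, 0 ≤ c i) (hm : ∀ i ∈ s, AEStronglyMeasurable (V i) P)
    (hV : ∀ i ∈ s, eLpNorm (V i) p P ≤ C) :
    eLpNorm (fun ω => ∑ i ∈ s, c i * V i ω) p P ≤ ENNReal.ofReal (∑ i ∈ s, c i) * C := by
  have h : (fun ω => ∑ i ∈ s, c i * V i ω) = ∑ i ∈ s, c i • V i := by
    ext ω; simp
  rw [h, ENNReal.ofReal_sum_of_nonneg hc, Finset.sum_mul]
  refine (eLpNorm_sum_le (fun i hi => (hm i hi).const_smul _) hp).trans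
    (Finset.sum_le_sum fun i hi => ?_)
  rw [eLpNorm_const_smul, Real.enorm_eq_ofReal (hc i hi)]
  gcongr
  exact hV i hi

/-! ### Cumulants of weighted sums of Lévy increments -/

section Increments

variable [IsProbabilityMeasure P] {Z : ℝ≥0 → Ω → ℝ}

lemma cumulant_map_zero (r : ℕ) : cumulant r (P.map fun _ => (0 : ℝ)) = 0 := by
  have h : logCharFun (P.map fun _ => (0 : ℝ)) = fun _ => 0 := by
    ext u
    simp [logCharFun, Measure.map_const]
  rw [cumulant, h, iteratedDeriv_fun_const_zero, mul_zero]

lemma IsLevyProcess.cumulant_sum_increments (hZ : IsLevyProcess P Z)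
    (hmom : ∀ (t : ℝ≥0) (p : ℕ), MemLp (Z t) p P) (T : ℝ≥0) (n : ℕ) (a : ℕ → ℝ) (r m : ℕ) :
    cumulant r (P.map fun ω => ∑ k ∈ Finset.range m,
        a k * (Z (grid T n (k + 1)) ω - Z (grid T n k) ω)) =
      ∑ k ∈ Finset.range m, (a k : ℂ) ^ r * cumulant r (P.map (Z (T / (n + 1)))) := by
  have hind := hZ.indepIncrements.nat (grid_mono T n)
  have hind' : iIndepFun (fun k ω => a k * (Z (grid T n (k + 1)) ω - Z (grid T n k) ω)) P :=
    iIndepFun.comp hind (fun k (x : ℝ) => a k * x) fun k => measurable_const_mul (a k)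
  have hL : ∀ k (p : ℕ), MemLp (fun ω => Z (grid T n (k + 1)) ω - Z (grid T n k) ω) p P :=
    fun k p => (hmom _ p).sub (hmom _ p)
  have hmeas : ∀ k, Measurable fun ω => a k * (Z (grid T n (k + 1)) ω - Z (grid T n k) ω) :=
    fun k => ((hZ.measurable _).sub (hZ.measurable _)).const_mul _
  induction m with
  | zero =>
    simp only [Finset.range_zero, Finset.sum_empty]
    exact cumulant_map_zero (P := P) r
  | succ m ih =>
    simp only [Finset.sum_range_succ]
    have hi : IndepFun (fun ω => ∑ k ∈ Finset.range m,
        a k * (Z (grid T n (k + 1)) ω - Z (grid T n k) ω))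
        (fun ω => a m * (Z (grid T n (m + 1)) ω - Z (grid T n m) ω)) P := by
      have := hind'.indepFun_finsetSum_of_notMem hmeas (s := Finset.range m) (i := m) (by simp)
      convert this using 1
      ext ω
      rw [Finset.sum_apply]
    rw [cumulant_map_add hi
      (fun p => memLp_finsetSum _ fun k _ => (hL k p).const_mul _)
      (fun p => (hL m p).const_mul _), ih, cumulant_map_const_mul (hL m)]
    congr 3
    rw [grid_succ]
    exact (hZ.stationaryIncrements _ _).map_eq

/-- With unit weights the increments telescope to `Z_T`, which is thus a sum of `n + 1` independent
copies of one cell increment. -/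
lemma IsLevyProcess.cumulant_cell (hZ : IsLevyProcess P Z)
    (hmom : ∀ (t : ℝ≥0) (p : ℕ), MemLp (Z t) p P) (T : ℝ≥0) (n r : ℕ) :
    cumulant r (P.map (Z (T / (n + 1)))) = ((n : ℂ) + 1)⁻¹ * cumulant r (P.map (Z T)) := by
  have h := hZ.cumulant_sum_increments hmom T n (fun _ => 1) r (n + 1)
  have h1 : (fun ω => ∑ k ∈ Finset.range (n + 1),
      (1 : ℝ) * (Z (grid T n (k + 1)) ω - Z (grid T n k) ω)) =ᵐ[P] Z T := by
    filter_upwards [hZ.zero] with ω hω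
    simp only [one_mul]
    rw [Finset.sum_range_sub (fun k => Z (grid T n k) ω), grid_last, grid_zero, hω, sub_zero]
  rw [Measure.map_congr h1] at h
  have hn : (n : ℂ) + 1 ≠ 0 := by exact_mod_cast n.succ_ne_zero
  rw [h]
  simp
  field_simp

end Increments

/-! ### Moment bounds and the cumulants of linear functionals of the noise -/

section Model

variable [IsProbabilityMeasure P] {lam gam bet rho : ℝ} {X Y Z : ℝ≥0 → Ω → ℝ}

omit [IsProbabilityMeasure P] in
lemma IsStrictlyStationary.identDistrib (hs : IsStrictlyStationary P X) (t : ℝ≥0) :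
    IdentDistrib (X t) (X 0) P P := by
  have := (hs t).comp (measurable_pi_apply (0 : ℝ≥0))
  simpa [Function.comp_def] using this

omit [IsProbabilityMeasure P] in
lemma IsModel.ae_cadlag (hm : IsModel P lam gam bet rho X Y Z) :
    ∀ᵐ ω ∂P, Cadlag fun t => Z t ω := hm.levy.cadlag

omit [IsProbabilityMeasure P] in
-- A Minkowski inequality obtained through Riemann sums: their weights add up to `t`, all samples
-- have the law of `X 0`, and Fatou passes the bound to the limit. Measurability of the integral
-- comes from the same limit, so joint measurability of `X` is not required.
lemma IsModel.memLp_integral (hm : IsModel P lam gam bet rho X Y Z)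
    (hs : IsStrictlyStationary P X) (t : ℝ≥0) {p : ℝ≥0∞} (hp : 1 ≤ p) :
    AEStronglyMeasurable (fun ω => ∫ s in (0 : ℝ)..t, X s.toNNReal ω) P ∧
    eLpNorm (fun ω => ∫ s in (0 : ℝ)..t, X s.toNNReal ω) p P ≤ t * eLpNorm (X 0) p P := by
  rcases eq_or_lt_of_le (zero_le : 0 ≤ t) with rfl | ht
  · simp [aestronglyMeasurable_const]
  have hlim : ∀ᵐ ω ∂P, Tendsto (fun n : ℕ => ∑ k ∈ Finset.range (n + 1),
      (∫ _ in (grid t n k : ℝ)..grid t n (k + 1), (1 : ℝ)) * X (grid t n (k + 1)) ω) atTop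
      (𝓝 (∫ s in (0 : ℝ)..t, X s.toNNReal ω)) := by
    filter_upwards [hm.ae_cadlag, hm.path_integrable, hm.eq_X] with ω h1 h2 h3
    have hc : Cadlag fun t => X t ω := cadlag_solution h1 h2 h3
    simpa using hc.tendsto_sum_grid (continuous_const (y := (1 : ℝ))) ht
  have hmeas : ∀ n : ℕ, AEStronglyMeasurable (fun ω => ∑ k ∈ Finset.range (n + 1),
      (∫ _ in (grid t n k : ℝ)..grid t n (k + 1), (1 : ℝ)) * X (grid t n (k + 1)) ω) P :=
    fun n => (Finset.measurable_fun_sum _ fun k _ =>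
      (hm.measurable_X _).const_mul _).aestronglyMeasurable
  refine ⟨aestronglyMeasurable_of_tendsto_ae atTop hmeas hlim,
    Lp.eLpNorm_le_of_ae_tendsto (Eventually.of_forall fun n => ?_) hmeas hlim⟩
  refine (eLpNorm_weighted_sum_le hp (fun k _ => ?_)
    (fun k _ => (hm.measurable_X _).aestronglyMeasurable)
    (fun k _ => ((hs.identDistrib _).eLpNorm_eq p).le)).trans_eq ?_
  · simp [grid_mono t n k.le_succ]
  · simp only [intervalIntegral.integral_const, smul_eq_mul, mul_one]
    rw [Finset.sum_range_sub (fun k => (grid t n k : ℝ)), grid_last, grid_zero]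
    simp

omit [IsProbabilityMeasure P] in
lemma IsModel.exists_bound_Z (hm : IsModel P lam gam bet rho X Y Z)
    (hs : IsStrictlyStationary P X) (hX : ∀ p : ℕ, MemLp (X 0) p P) (T : ℝ≥0) (p : ℕ) :
    ∃ C : ℝ≥0, ∀ t ≤ T, eLpNorm (Z t) p P ≤ C := by
  rcases Nat.eq_zero_or_pos p with rfl | hp
  · exact ⟨0, by simp⟩
  have hp1 : (1 : ℝ≥0∞) ≤ p := by exact_mod_cast hp
  obtain ⟨D, hD⟩ : ∃ D : ℝ≥0, (D : ℝ≥0∞) = eLpNorm (X 0) p P :=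
    ⟨_, ENNReal.coe_toNNReal (hX p).2.ne⟩
  refine ⟨D + D + ‖lam‖₊ * (T * D), fun t ht => ?_⟩
  obtain ⟨hI, hIb⟩ := hm.memLp_integral hs t hp1
  have hmX := fun t => (hm.measurable_X t).aestronglyMeasurable (μ := P)
  -- Reading the equation backwards bounds the noise by the stationary process.
  have hZ : Z t =ᵐ[P] (X t - X 0) + lam • fun ω => ∫ s in (0 : ℝ)..t, X s.toNNReal ω := by
    filter_upwards [hm.eq_X] with ω h
    simp only [Pi.add_apply, Pi.sub_apply, Pi.smul_apply, smul_eq_mul]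
    rw [h t]; ring
  rw [eLpNorm_congr_ae hZ]
  calc _ ≤ eLpNorm (X t) p P + eLpNorm (X 0) p P +
        eLpNorm (lam • fun ω => ∫ s in (0 : ℝ)..t, X s.toNNReal ω) p P :=
        (eLpNorm_add_le ((hmX t).sub (hmX 0)) (hI.const_smul _) hp1).trans
          (add_le_add (eLpNorm_sub_le (hmX t) (hmX 0) hp1) le_rfl)
    _ ≤ D + D + ‖lam‖₊ * (T * D) := by
        rw [(hs.identDistrib t).eLpNorm_eq, ← hD, eLpNorm_const_smul]
        refine add_le_add le_rfl (mul_le_mul' le_rfl (hIb.trans ?_))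
        rw [← hD]
        gcongr
    _ = _ := by push_cast; rfl

omit [IsProbabilityMeasure P] in
lemma IsModel.memLp_Z (hm : IsModel P lam gam bet rho X Y Z)
    (hs : IsStrictlyStationary P X) (hX : ∀ p : ℕ, MemLp (X 0) p P) (T : ℝ≥0) (p : ℕ) :
    MemLp (Z T) p P := by
  obtain ⟨C, hC⟩ := hm.exists_bound_Z hs hX T p
  exact ⟨(hm.levy.measurable T).aestronglyMeasurable, (hC T le_rfl).trans_lt ENNReal.coe_lt_top⟩

lemma IsModel.memLp_Y (hm : IsModel P lam gam bet rho X Y Z)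
    (hs : IsStrictlyStationary P X) (hX : ∀ p : ℕ, MemLp (X 0) p P) (T : ℝ≥0) (p : ℕ) :
    MemLp (Y T) p P := by
  suffices h : ∀ q : ℕ, 1 ≤ q → MemLp (Y T) q P from
    (h (p + 1) (by omega)).mono_exponent (by exact_mod_cast p.le_succ)
  intro q hq
  obtain ⟨hI, hIb⟩ := hm.memLp_integral hs T (p := q) (by exact_mod_cast hq)
  have hIL : MemLp (fun ω => ∫ s in (0 : ℝ)..T, X s.toNNReal ω) q P :=
    ⟨hI, hIb.trans_lt (ENNReal.mul_lt_top ENNReal.coe_lt_top (hX q).2)⟩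
  refine MemLp.ae_eq ?_ (((memLp_const (gam * T)).add (hIL.const_mul bet)).add
    ((hm.memLp_Z hs hX T q).const_mul rho))
  filter_upwards [hm.eq_Y, hm.path_integrable] with ω h1 h2
  rw [h1 T, intervalIntegral.integral_add intervalIntegrable_const ((h2 T).const_mul _),
    intervalIntegral.integral_const_mul]
  simp [mul_comm]

lemma sum_mul_sub_eq (v z : ℕ → ℝ) (m : ℕ) :
    ∑ k ∈ Finset.range m, v k * (z (k + 1) - z k) =
      ∑ k ∈ Finset.range m, (v k - v (k + 1)) * z (k + 1) + (v m * z m - v 0 * z 0) := by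
  rw [← Finset.sum_range_sub (fun k => v k * z k), ← Finset.sum_add_distrib]
  exact Finset.sum_congr rfl fun k _ => by ring

lemma continuous_eta (lam : ℝ) : Continuous (eta lam) := by
  unfold eta; fun_prop

lemma eta_zero (lam : ℝ) : eta lam 0 = 0 := by simp [eta]

lemma cell_integral_eq (hlam : 0 < lam) (T : ℝ≥0) (a b : ℝ) :
    ∫ u in a..b, Real.exp (-(lam * (T - u))) = eta lam (T - a) - eta lam (T - b) := by
  have hc : Continuous fun u : ℝ => Real.exp (-(lam * (T - u))) := by fun_prop
  rw [← integral_exp_eq_eta hlam, ← integral_exp_eq_eta hlam, eq_sub_iff_add_eq,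
    intervalIntegral.integral_add_adjacent_intervals (hc.intervalIntegrable _ _)
      (hc.intervalIntegrable _ _)]

lemma tendsto_riemann_sum {q : ℝ → ℝ} (hq : Continuous q) {T : ℝ≥0} (hT : 0 < T) :
    Tendsto (fun n : ℕ => ∑ k ∈ Finset.range (n + 1), ((n : ℝ) + 1)⁻¹ * q (T - grid T n k)) atTop
      (𝓝 ((T : ℝ)⁻¹ * ∫ s in (0 : ℝ)..T, q s)) := by
  have hcad : Cadlag fun t : ℝ≥0 => q t := fun t =>
    ⟨(hq.comp NNReal.continuous_coe).continuousWithinAt, _,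
      ((hq.comp NNReal.continuous_coe).tendsto t).mono_left nhdsWithin_le_nhds⟩
  have h := (hcad.tendsto_sum_grid (continuous_const (y := (1 : ℝ))) hT).const_mul (T : ℝ)⁻¹
  have hT' : (T : ℝ) ≠ 0 := by exact_mod_cast hT.ne'
  have hint : ∫ s in (0 : ℝ)..T, (1 : ℝ) * q s.toNNReal = ∫ s in (0 : ℝ)..T, q s := by
    refine intervalIntegral.integral_congr fun s hs => ?_
    rw [Set.uIcc_of_le T.coe_nonneg] at hs
    simp [Real.coe_toNNReal _ hs.1]
  rw [hint] at h
  refine h.congr fun n => ?_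
  -- Reversing the order turns the nodes `T - grid T n k` into the right endpoints of the cells.
  rw [Finset.mul_sum, ← Finset.sum_range_reflect]
  refine Finset.sum_congr rfl fun k hk => ?_
  have hk' : k ≤ n := Nat.lt_succ_iff.1 (Finset.mem_range.1 hk)
  have hn : (n : ℝ) + 1 ≠ 0 := by positivity
  have e1 : n + 1 - 1 - k + 1 = n + 1 - k := by omega
  have e2 : (grid T n (n + 1 - k) : ℝ) = T - grid T n k := by
    simp only [grid, NNReal.coe_mul, NNReal.coe_natCast, Nat.cast_sub (by omega : k ≤ n + 1)]
    push_cast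
    field_simp
  have e3 : (grid T n (n + 1 - 1 - k + 1) : ℝ) - grid T n (n + 1 - 1 - k) = T / (n + 1) := by
    rw [grid_succ]; push_cast; ring
  rw [intervalIntegral.integral_const, e3, e1, e2]
  simp only [smul_eq_mul, mul_one]
  field_simp

/-- The cumulants of `a X₀ + b ∫₀ᵀ exp(-lam (T - s)) Z_s ds + c Z_T`. -/
lemma IsModel.cumulant_linear_combination (hlam : 0 < lam)
    (hm : IsModel P lam gam bet rho X Y Z) (hs : IsStrictlyStationary P X)
    (hX : ∀ p : ℕ, MemLp (X 0) p P) {T : ℝ≥0} (hT : 0 < T) (a b c : ℝ) (r : ℕ) :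
    cumulant r (P.map fun ω => a * X 0 ω +
        (b * (∫ s in (0 : ℝ)..T, Real.exp (-(lam * (T - s))) * Z s.toNNReal ω) + c * Z T ω)) =
      (a : ℂ) ^ r * cumulant r (P.map (X 0)) +
        (((T : ℝ)⁻¹ * ∫ s in (0 : ℝ)..T, (b * eta lam s + c) ^ r : ℝ) : ℂ) *
          cumulant r (P.map (Z T)) := by
  set w : ℝ → ℝ := fun s => Real.exp (-(lam * (T - s))) with hw
  have hwc : Continuous w := by fun_prop
  set J : ℕ → Ω → ℝ := fun n ω => ∑ k ∈ Finset.range (n + 1),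
    (∫ s in (grid T n k : ℝ)..grid T n (k + 1), w s) * Z (grid T n (k + 1)) ω with hJ
  have hJm : ∀ n, Measurable (J n) := fun n =>
    Finset.measurable_fun_sum _ fun k _ => (hm.levy.measurable _).const_mul _
  have hZL := hm.memLp_Z hs hX
  set S : ℕ → Ω → ℝ := fun n ω => ∑ k ∈ Finset.range (n + 1),
    (b * eta lam (T - grid T n k) + c) * (Z (grid T n (k + 1)) ω - Z (grid T n k) ω) with hS
  -- The cell integrals are differences of `eta`, so summation by parts moves the differences onto
  -- `Z`; the boundary terms vanish because `η(0) = 0` and `Z_0 = 0`.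
  have hJS : ∀ n, (fun ω => b * J n ω + c * Z T ω) =ᵐ[P] S n := by
    intro n
    filter_upwards [hm.levy.zero] with ω h0
    have h1 := sum_mul_sub_eq (fun k => eta lam (T - grid T n k)) (fun k => Z (grid T n k) ω) (n + 1)
    simp only [grid_last, grid_zero, h0, sub_self, eta_zero, zero_mul, mul_zero, add_zero] at h1
    have h2 : ∑ k ∈ Finset.range (n + 1), (Z (grid T n (k + 1)) ω - Z (grid T n k) ω) = Z T ω := by
      rw [Finset.sum_range_sub (fun k => Z (grid T n k) ω), grid_last, grid_zero, h0, sub_zero]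
    simp only [hJ, hS, hw, cell_integral_eq hlam]
    rw [← h1, ← h2, Finset.mul_sum, Finset.mul_sum, ← Finset.sum_add_distrib]
    exact Finset.sum_congr rfl fun k _ => by ring
  have hlim : ∀ᵐ ω ∂P, Tendsto (fun n => a * X 0 ω + (b * J n ω + c * Z T ω)) atTop
      (𝓝 (a * X 0 ω + (b * (∫ s in (0 : ℝ)..T, w s * Z s.toNNReal ω) + c * Z T ω))) := by
    filter_upwards [hm.ae_cadlag] with ω h
    exact (((h.tendsto_sum_grid hwc hT).const_mul b).add_const _).const_add _
  have hbound : ∀ p : ℕ, ∃ C : ℝ≥0, ∀ n,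
      eLpNorm (fun ω => a * X 0 ω + (b * J n ω + c * Z T ω)) p P ≤ C := by
    intro p
    rcases Nat.eq_zero_or_pos p with rfl | hp
    · exact ⟨0, by simp⟩
    have hp1 : (1 : ℝ≥0∞) ≤ p := by exact_mod_cast hp
    obtain ⟨D, hD⟩ := hm.exists_bound_Z hs hX T p
    obtain ⟨E, hE⟩ : ∃ E : ℝ≥0, (E : ℝ≥0∞) = eLpNorm (X 0) p P :=
      ⟨_, ENNReal.coe_toNNReal (hX p).2.ne⟩
    -- The weights are nonnegative and telescope to `η(T)`, independently of `n`.
    have hJb : ∀ n, eLpNorm (J n) p P ≤ ENNReal.ofReal (eta lam T) * D := by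
      intro n
      refine (eLpNorm_weighted_sum_le hp1 (fun k _ => ?_)
        (fun k _ => (hm.levy.measurable _).aestronglyMeasurable) (fun k hk => hD _ ?_)).trans_eq ?_
      · refine intervalIntegral.integral_nonneg ?_ fun s _ => (Real.exp_pos _).le
        exact_mod_cast grid_mono T n k.le_succ
      · calc grid T n (k + 1) ≤ grid T n (n + 1) := grid_mono T n (Finset.mem_range.1 hk)
          _ = T := grid_last T n
      · simp only [hw, cell_integral_eq hlam]
        rw [Finset.sum_range_sub' (fun k => eta lam (T - grid T n k)), grid_last, grid_zero]
        simp [eta_zero]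
    refine ⟨‖a‖₊ * E + (‖b‖₊ * ((eta lam T).toNNReal * D) + ‖c‖₊ * D), fun n => ?_⟩
    have mX := (hm.measurable_X 0).aestronglyMeasurable (μ := P)
    have mZ := (hm.levy.measurable T).aestronglyMeasurable (μ := P)
    have mJ := (hJm n).aestronglyMeasurable (μ := P)
    calc eLpNorm (fun ω => a * X 0 ω + (b * J n ω + c * Z T ω)) p P
        = eLpNorm (a • X 0 + (b • J n + c • Z T)) p P := rfl
      _ ≤ eLpNorm (a • X 0) p P + (eLpNorm (b • J n) p P + eLpNorm (c • Z T) p P) :=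
          (eLpNorm_add_le (mX.const_smul _) ((mJ.const_smul _).add (mZ.const_smul _)) hp1).trans
            (add_le_add le_rfl (eLpNorm_add_le (mJ.const_smul _) (mZ.const_smul _) hp1))
      _ ≤ ‖a‖₊ * E + (‖b‖₊ * ((eta lam T).toNNReal * D) + ‖c‖₊ * D) := by
          rw [eLpNorm_const_smul, eLpNorm_const_smul, eLpNorm_const_smul, ← hE]
          exact add_le_add le_rfl (add_le_add (mul_le_mul' le_rfl (hJb n))
            (mul_le_mul' le_rfl (hD T le_rfl)))
      _ = _ := by push_cast; rfl
  have hconv := tendsto_cumulant_map (P := P)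
    (fun n => (((hm.measurable_X 0).const_mul a).add
      (((hJm n).const_mul b).add ((hm.levy.measurable T).const_mul c))).aestronglyMeasurable)
    hbound hlim r
  -- The same cumulants are now computed exactly for each `n` and recognised as Riemann sums of `(b
  -- η + c)^r`.
  refine tendsto_nhds_unique hconv ?_
  have hval : ∀ n : ℕ, cumulant r (P.map fun ω => a * X 0 ω + (b * J n ω + c * Z T ω)) =
      (a : ℂ) ^ r * cumulant r (P.map (X 0)) +
        ((∑ k ∈ Finset.range (n + 1), ((n : ℝ) + 1)⁻¹ *
          (b * eta lam (T - grid T n k) + c) ^ r : ℝ) : ℂ) * cumulant r (P.map (Z T)) := by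
    intro n
    have hae : (fun ω => a * X 0 ω + (b * J n ω + c * Z T ω)) =ᵐ[P]
        fun ω => a * X 0 ω + S n ω := by
      filter_upwards [hJS n] with ω h
      rw [h]
    have hind : IndepFun (fun ω => a * X 0 ω) (S n) P := by
      refine hm.indep.comp (φ := fun x => a * x) (ψ := fun z : ℝ≥0 → ℝ =>
        ∑ k ∈ Finset.range (n + 1), (b * eta lam (T - grid T n k) + c) *
          (z (grid T n (k + 1)) - z (grid T n k))) (measurable_const_mul a) ?_
      exact Finset.measurable_fun_sum _ fun k _ =>
        Measurable.const_mul ((measurable_pi_apply (grid T n (k + 1))).fun_sub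
          (measurable_pi_apply (grid T n k))) _
    have hSL : ∀ p : ℕ, MemLp (S n) p P := fun p =>
      memLp_finsetSum _ fun k _ => ((hZL _ p).sub (hZL _ p)).const_mul _
    rw [Measure.map_congr hae, cumulant_map_add hind (fun p => (hX p).const_mul a) hSL,
      cumulant_map_const_mul hX, hm.levy.cumulant_sum_increments hZL,
      hm.levy.cumulant_cell hZL]
    congr 1
    push_cast
    rw [Finset.sum_mul]
    exact Finset.sum_congr rfl fun k _ => by ring
  refine Tendsto.congr (fun n => (hval n).symm) ?_
  have hq : Continuous fun s => (b * eta lam s + c) ^ r :=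
    (((continuous_eta lam).const_mul b).add continuous_const).pow r
  exact (((Complex.continuous_ofReal.tendsto _).comp (tendsto_riemann_sum hq hT)).mul_const
    _).const_add _

end Model

/-! ### Closed forms for the integrals of powers of `eta` -/

section Integrals

variable {lam : ℝ}

lemma one_sub_mul_eta (hlam : 0 < lam) (u : ℝ) : 1 - lam * eta lam u = Real.exp (-(lam * u)) := by
  rw [eta, mul_inv_cancel_left₀ hlam.ne']; ring

lemma hasDerivAt_eta (hlam : 0 < lam) (u : ℝ) :
    HasDerivAt (fun u => lam * eta lam u) (lam * (1 - lam * eta lam u)) u := by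
  have h1 : HasDerivAt (fun u => -(lam * u)) (-lam) u := by
    simpa using ((hasDerivAt_id u).const_mul lam).fun_neg
  have h2 := (h1.exp.const_sub 1)
  have h3 : (fun u => lam * eta lam u) = fun u => 1 - Real.exp (-(lam * u)) := by
    funext u; rw [← one_sub_mul_eta hlam]; ring
  rw [h3, one_sub_mul_eta hlam]
  exact h2.congr_deriv (by ring)

/-- The function `v = lam η` satisfies `v' = lam (1 - v)`, so `v^j - v^(j+1)` is the derivative of
`v^(j+1) / (lam (j+1))`; each induction step adds one term. -/
lemma integral_mul_eta_pow (hlam : 0 < lam) (T : ℝ) (j : ℕ) :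
    ∫ s in (0 : ℝ)..T, (lam * eta lam s) ^ j =
      T - lam⁻¹ * ∑ k ∈ Finset.Icc 1 j, (k : ℝ)⁻¹ * (lam * eta lam T) ^ k := by
  have hc : Continuous fun s => lam * eta lam s := continuous_const.mul (continuous_eta lam)
  induction j with
  | zero => simp
  | succ j ih =>
    have hd : ∀ s ∈ Set.uIcc 0 T,
        HasDerivAt (fun s => lam⁻¹ * (((j + 1 : ℕ) : ℝ)⁻¹ * (lam * eta lam s) ^ (j + 1)))
          ((lam * eta lam s) ^ j - (lam * eta lam s) ^ (j + 1)) s := by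
      intro s _
      refine ((((hasDerivAt_eta hlam s).fun_pow (j + 1)).const_mul _).const_mul _).congr_deriv ?_
      have : ((j + 1 : ℕ) : ℝ) ≠ 0 := by exact_mod_cast j.succ_ne_zero
      simp only [Nat.add_sub_cancel]
      field_simp
      ring
    have hi : ∀ m : ℕ, IntervalIntegrable (fun s => (lam * eta lam s) ^ m) volume 0 T :=
      fun m => (hc.pow m).intervalIntegrable _ _
    have h := intervalIntegral.integral_eq_sub_of_hasDerivAt hd ((hi j).sub (hi (j + 1)))
    rw [intervalIntegral.integral_sub (hi j) (hi (j + 1)), ih] at h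
    simp only [eta_zero, mul_zero, ne_eq, Nat.add_eq_zero_iff, one_ne_zero, and_false,
      not_false_eq_true, zero_pow, sub_zero] at h
    rw [Finset.sum_Icc_succ_top (by omega), mul_add]
    linarith

lemma integral_eta_pow (hlam : 0 < lam) {T : ℝ} (hT : 0 < T) (j : ℕ) :
    ∫ s in (0 : ℝ)..T, eta lam s ^ j = T * calM lam T j := by
  rcases Nat.eq_zero_or_pos j with rfl | hj
  · simp [calM]
  have h := integral_mul_eta_pow hlam T j
  simp only [mul_pow lam (eta lam _) j] at h
  rw [intervalIntegral.integral_const_mul] at h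
  rw [calM, if_neg hj.ne']
  refine mul_left_cancel₀ (pow_ne_zero j hlam.ne') (h.trans ?_)
  field_simp
  ring

lemma integral_affine_eta_pow (hlam : 0 < lam) {T : ℝ} (hT : 0 < T) (bet rho : ℝ) (r : ℕ) :
    ∫ s in (0 : ℝ)..T, (bet * eta lam s + rho) ^ r =
      T * ∑ j ∈ Finset.range (r + 1),
        (r.choose j : ℝ) * rho ^ (r - j) * bet ^ j * calM lam T j := by
  have h : ∀ s, (bet * eta lam s + rho) ^ r = ∑ j ∈ Finset.range (r + 1),
      ((r.choose j : ℝ) * rho ^ (r - j) * bet ^ j) * eta lam s ^ j := by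
    intro s
    rw [add_pow]
    exact Finset.sum_congr rfl fun j _ => by rw [mul_pow]; ring
  simp only [h]
  have hi : ∀ (c : ℝ) (j : ℕ), IntervalIntegrable (fun s => c * eta lam s ^ j) volume 0 T :=
    fun c j => (((continuous_eta lam).pow j).const_mul c).intervalIntegrable _ _
  rw [intervalIntegral.integral_finsetSum fun j _ => hi _ j, Finset.mul_sum]
  refine Finset.sum_congr rfl fun j _ => ?_
  rw [intervalIntegral.integral_const_mul, integral_eta_pow hlam hT]
  ring

lemma integral_exp_pow (hlam : 0 < lam) (T : ℝ) {r : ℕ} (hr : 0 < r) :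
    ∫ s in (0 : ℝ)..T, (-lam * eta lam s + 1) ^ r =
      (lam * r)⁻¹ * (1 - Real.exp (-(lam * T)) ^ r) := by
  have hr' : (0 : ℝ) < r := by exact_mod_cast hr
  have h : ∀ s, (-lam * eta lam s + 1) ^ r = Real.exp (-(lam * r) * s) := by
    intro s
    have : -lam * eta lam s + 1 = 1 - lam * eta lam s := by ring
    rw [this, one_sub_mul_eta hlam, ← Real.exp_nat_mul]
    ring_nf
  have hne : -(lam * r) ≠ 0 := neg_ne_zero.2 (by positivity)
  simp only [h]
  rw [intervalIntegral.integral_comp_mul_left (fun x => Real.exp x) hne, integral_exp,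
    ← Real.exp_nat_mul, mul_zero, Real.exp_zero, smul_eq_mul, inv_neg]
  ring_nf

end Integrals

/-! ### Limits of the explicit factors as `T → ∞` -/

section Limits

variable {lam : ℝ}

lemma tendsto_eta (hlam : 0 < lam) : Tendsto (fun T : ℝ≥0 => eta lam T) atTop (𝓝 lam⁻¹) := by
  have h1 : Tendsto (fun T : ℝ≥0 => lam * (T : ℝ)) atTop atTop :=
    (NNReal.tendsto_coe_atTop.2 tendsto_id).const_mul_atTop hlam
  have h2 := ((Real.tendsto_exp_neg_atTop_nhds_zero.comp h1).const_sub 1).const_mul lam⁻¹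
  simpa [eta, Function.comp_def] using h2

lemma tendsto_inv_coe : Tendsto (fun T : ℝ≥0 => (T : ℝ)⁻¹) atTop (𝓝 0) :=
  tendsto_inv_atTop_zero.comp (NNReal.tendsto_coe_atTop.2 tendsto_id)

lemma tendsto_calM (hlam : 0 < lam) (j : ℕ) :
    Tendsto (fun T : ℝ≥0 => calM lam T j) atTop (𝓝 (lam ^ j)⁻¹) := by
  rcases Nat.eq_zero_or_pos j with rfl | hj
  · simp [calM]
  simp only [calM, if_neg hj.ne']
  have h := ((tendsto_inv_coe.mul_const (lam ^ (j + 1))⁻¹).mul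
    (tendsto_finsetSum (Finset.Icc 1 j) fun k _ =>
      (((tendsto_eta hlam).const_mul lam).pow k).const_mul (k : ℝ)⁻¹)).const_sub (lam ^ j)⁻¹
  simpa using h

/-- The factor in front of `T^{-(r-2)/2} κ_F^{(r)}` in `χ_{r,T}`. -/
noncomputable def chiFactor (lam bet rho : ℝ) (r : ℕ) (T : ℝ) : ℝ :=
  T⁻¹ * (bet * eta lam T) ^ r +
    lam * r * ∑ j ∈ Finset.range (r + 1),
      (r.choose j : ℝ) * rho ^ (r - j) * bet ^ j * calM lam T j

lemma tendsto_chiFactor (hlam : 0 < lam) (bet rho : ℝ) (r : ℕ) :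
    Tendsto (fun T : ℝ≥0 => chiFactor lam bet rho r T) atTop
      (𝓝 (lam * r * ∑ j ∈ Finset.range (r + 1),
        (r.choose j : ℝ) * rho ^ (r - j) * bet ^ j * (lam ^ j)⁻¹)) := by
  have h := (tendsto_inv_coe.mul (((tendsto_eta hlam).const_mul bet).pow r)).add
    ((tendsto_finsetSum (Finset.range (r + 1)) fun j _ =>
      (tendsto_calM hlam j).const_mul ((r.choose j : ℝ) * rho ^ (r - j) * bet ^ j)).const_mul
        (lam * r))
  simpa [chiFactor] using h

end Limits

/-! ### Cumulants of `Z_T`, `Y_T` and the scaled process, and their asymptotics -/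

section Model

variable {Ω : Type*} [MeasurableSpace Ω] {P : Measure Ω} [IsProbabilityMeasure P]
  {lam gam bet rho : ℝ} {X Y Z : ℝ≥0 → Ω → ℝ}

/-- Taking `a = exp(-lam T)`, `b = -lam`, `c = 1` produces `X_T`, which has the law of `X 0`. Both
sides of the resulting equation carry the factor `1 - exp(-lam T)^r`, nonzero since `r`, `lam` and
`T` are positive. -/
lemma IsModel.cumulant_Z (hlam : 0 < lam)
    (hm : IsModel P lam gam bet rho X Y Z) (hs : IsStrictlyStationary P X)
    (hX : ∀ p : ℕ, MemLp (X 0) p P) {T : ℝ≥0} (hT : 0 < T) {r : ℕ} (hr : 0 < r) :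
    cumulant r (P.map (Z T)) = ((lam * r * T : ℝ) : ℂ) * cumulant r (P.map (X 0)) := by
  have hT' : (0 : ℝ) < T := hT
  have hr' : (0 : ℝ) < r := by exact_mod_cast hr
  have h := hm.cumulant_linear_combination hlam hs hX hT (Real.exp (-(lam * T))) (-lam) 1 r
  have hae : (fun ω => Real.exp (-(lam * T)) * X 0 ω +
      (-lam * (∫ s in (0 : ℝ)..T, Real.exp (-(lam * (T - s))) * Z s.toNNReal ω) + 1 * Z T ω))
      =ᵐ[P] X T := by
    filter_upwards [hm.ae_cadlag, hm.path_integrable, hm.eq_X] with ω h1 h2 h3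
    have h4 := integral_solution hlam h1 h2 h3 T
    rw [h3 T, h4, ← one_sub_mul_eta hlam]
    ring
  rw [Measure.map_congr hae, (hs.identDistrib T).map_eq, integral_exp_pow hlam _ hr] at h
  have he : Real.exp (-(lam * T)) ^ r < 1 :=
    pow_lt_one₀ (Real.exp_pos _).le (Real.exp_lt_one_iff.2 (by simp; positivity)) hr.ne'
  set E : ℝ := Real.exp (-(lam * T)) ^ r with hE
  have hE' : ((Real.exp (-(lam * T)) : ℝ) : ℂ) ^ r = (E : ℂ) := by rw [hE]; push_cast; rfl
  rw [hE'] at h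
  have hne : (1 - E : ℂ) ≠ 0 := by
    have : (1 - E : ℝ) ≠ 0 := (sub_pos.2 he).ne'
    exact_mod_cast this
  have hlc : (lam : ℂ) ≠ 0 := by exact_mod_cast hlam.ne'
  have hrc : (r : ℂ) ≠ 0 := by exact_mod_cast hr.ne'
  have hTc : ((T : ℝ) : ℂ) ≠ 0 := by exact_mod_cast hT'.ne'
  refine mul_left_cancel₀ hne ?_
  push_cast at h ⊢
  field_simp at h
  linear_combination -h

/-- Taking `a = bet η(T)`, `b = bet`, `c = rho` produces `Y_T - gam T`; the drift is invisible to
cumulants of order at least two. -/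
lemma IsModel.cumulant_Y (hlam : 0 < lam)
    (hm : IsModel P lam gam bet rho X Y Z) (hs : IsStrictlyStationary P X)
    (hX : ∀ p : ℕ, MemLp (X 0) p P) {T : ℝ≥0} (hT : 0 < T) {r : ℕ} (hr : 2 ≤ r) :
    cumulant r (P.map (Y T)) =
      ((T * chiFactor lam bet rho r T : ℝ) : ℂ) * cumulant r (P.map (X 0)) := by
  have hT' : (0 : ℝ) < T := hT
  have h := hm.cumulant_linear_combination hlam hs hX hT (bet * eta lam T) bet rho r
  set U : Ω → ℝ := fun ω => bet * eta lam T * X 0 ω +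
      (bet * (∫ s in (0 : ℝ)..T, Real.exp (-(lam * (T - s))) * Z s.toNNReal ω) + rho * Z T ω)
    with hU
  have hae : (fun ω => Y T ω + -(gam * T)) =ᵐ[P] U := by
    filter_upwards [hm.ae_cadlag, hm.path_integrable, hm.eq_X, hm.eq_Y] with ω h1 h2 h3 h5
    have h4 := integral_solution hlam h1 h2 h3 T
    rw [h5 T, intervalIntegral.integral_add intervalIntegrable_const ((h2 T).const_mul _),
      intervalIntegral.integral_const_mul, h4]
    simp only [hU, intervalIntegral.integral_const, smul_eq_mul]
    ring
  rw [← cumulant_map_add_const (hm.memLp_Y hs hX T) (-(gam * T)) hr, Measure.map_congr hae, h,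
    hm.cumulant_Z hlam hs hX hT (by omega), integral_affine_eta_pow hlam hT', chiFactor]
  have hTc : ((T : ℝ) : ℂ) ≠ 0 := by exact_mod_cast hT'.ne'
  push_cast
  field_simp

lemma IsModel.memLp_scaledH (hm : IsModel P lam gam bet rho X Y Z)
    (hs : IsStrictlyStationary P X) (hX : ∀ p : ℕ, MemLp (X 0) p P) (T : ℝ≥0) (p : ℕ) :
    MemLp (scaledH P Y T) p P :=
  ((hm.memLp_Y hs hX T p).sub (memLp_const _)).const_mul _

lemma IsModel.chi_eq (hlam : 0 < lam)
    (hm : IsModel P lam gam bet rho X Y Z) (hs : IsStrictlyStationary P X)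
    (hX : ∀ p : ℕ, MemLp (X 0) p P) {T : ℝ≥0} (hT : 0 < T) {r : ℕ} (hr : 2 ≤ r) :
    chi P Y r T = (((T : ℝ) ^ (-((r : ℝ) - 2) / 2) * chiFactor lam bet rho r T : ℝ) : ℂ) *
      cumulant r (P.map (X 0)) := by
  have hT' : (0 : ℝ) < T := hT
  have hY := hm.memLp_Y hs hX T
  have h1 : scaledH P Y T = fun ω => (T : ℝ) ^ (-(1 / 2) : ℝ) * (Y T ω + -∫ ω', Y T ω' ∂P) := by
    funext ω; rw [scaledH, sub_eq_add_neg]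
  rw [chi, h1, cumulant_map_const_mul (U := fun ω => Y T ω + -∫ ω', Y T ω' ∂P)
      (fun p => (hY p).add (memLp_const _)),
    cumulant_map_add_const hY _ hr, hm.cumulant_Y hlam hs hX hT hr, ← mul_assoc]
  congr 1
  -- Scaling contributes `T^(-r/2)`, and one power of `T` comes from the cumulant of `Y_T`.
  have h2 : ((T : ℝ) ^ (-(1 / 2) : ℝ)) ^ r * T = (T : ℝ) ^ (-((r : ℝ) - 2) / 2) := by
    rw [← Real.rpow_natCast, ← Real.rpow_mul hT'.le]
    nth_rw 2 [← Real.rpow_one (T : ℝ)]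
    rw [← Real.rpow_add hT']
    ring_nf
  rw [← h2]
  push_cast
  ring

lemma IsModel.chi_two_eq (hm : IsModel P lam gam bet rho X Y Z) (hs : IsStrictlyStationary P X)
    (hX : ∀ p : ℕ, MemLp (X 0) p P) (T : ℝ≥0) :
    chi P Y 2 T = ((∫ ω, scaledH P Y T ω ^ 2 ∂P : ℝ) : ℂ) := by
  have hL := hm.memLp_scaledH hs hX T
  have hmeas : AEMeasurable (scaledH P Y T) P := (hL 0).1.aemeasurable
  have := Measure.isProbabilityMeasure_map hmeas
  have h0 : ∫ ω, scaledH P Y T ω ∂P = 0 := by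
    have hi : Integrable (Y T) P := memLp_one_iff_integrable.1 (by simpa using hm.memLp_Y hs hX T 1)
    unfold scaledH
    rw [integral_const_mul, integral_sub hi (integrable_const _)]
    simp
  rw [chi, cumulant_two (memLp_id_map hmeas hL), integral_map hmeas (by fun_prop),
    integral_map hmeas (by fun_prop), h0]
  simp

lemma IsModel.tendsto_scaled_chi (hlam : 0 < lam)
    (hm : IsModel P lam gam bet rho X Y Z) (hs : IsStrictlyStationary P X)
    (hX : ∀ p : ℕ, MemLp (X 0) p P) {r : ℕ} (hr : 2 ≤ r) :
    Tendsto (fun T : ℝ≥0 => (((T : ℝ) ^ (((r : ℝ) - 2) / 2) : ℝ) : ℂ) * chi P Y r T) atTop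
      (𝓝 (((lam * r * ∑ j ∈ Finset.range (r + 1),
          (r.choose j : ℝ) * rho ^ (r - j) * bet ^ j * (lam ^ j)⁻¹ : ℝ) : ℂ) *
            cumulant r (P.map (X 0)))) := by
  refine (((Complex.continuous_ofReal.tendsto _).comp
    (tendsto_chiFactor hlam bet rho r)).mul_const _).congr' ?_
  filter_upwards [eventually_gt_atTop 0] with T hT
  have hT' : (0 : ℝ) < T := hT
  rw [hm.chi_eq hlam hs hX hT hr, ← mul_assoc, ← Complex.ofReal_mul, ← mul_assoc,
    ← Real.rpow_add hT']
  have : ((r : ℝ) - 2) / 2 + -((r : ℝ) - 2) / 2 = 0 := by ring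
  rw [this, Real.rpow_zero, one_mul]
  rfl

lemma IsModel.isBigO_chi (hlam : 0 < lam)
    (hm : IsModel P lam gam bet rho X Y Z) (hs : IsStrictlyStationary P X)
    (hX : ∀ p : ℕ, MemLp (X 0) p P) {r : ℕ} (hr : 2 ≤ r) :
    (fun T : ℝ≥0 => chi P Y r T) =O[atTop]
      (fun T : ℝ≥0 => (T : ℝ) ^ (-((r : ℝ) - 2) / 2)) := by
  have h1 := (hm.tendsto_scaled_chi hlam hs hX hr).isBigO_one ℝ
  have h2 := (isBigO_refl (fun T : ℝ≥0 => (T : ℝ) ^ (-((r : ℝ) - 2) / 2)) atTop).smul h1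
  refine (h2.congr' ?_ ?_)
  · filter_upwards [eventually_gt_atTop 0] with T hT
    have hT' : (0 : ℝ) < T := hT
    have : -((r : ℝ) - 2) / 2 + ((r : ℝ) - 2) / 2 = 0 := by ring
    rw [Complex.real_smul, ← mul_assoc, ← Complex.ofReal_mul, ← Real.rpow_add hT', this,
      Real.rpow_zero, Complex.ofReal_one, one_mul]
  · filter_upwards with T
    simp

lemma IsModel.tendsto_chi_two (hlam : 0 < lam)
    (hm : IsModel P lam gam bet rho X Y Z) (hs : IsStrictlyStationary P X)
    (hX : ∀ p : ℕ, MemLp (X 0) p P) :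
    Tendsto (fun T : ℝ≥0 => chi P Y 2 T) atTop
      (𝓝 (((2 * lam⁻¹ * (bet + rho * lam) ^ 2 : ℝ) : ℂ) * cumulant 2 (P.map (X 0)))) := by
  have h := hm.tendsto_scaled_chi hlam hs hX (le_refl 2)
  have hlim : lam * (2 : ℕ) * ∑ j ∈ Finset.range (2 + 1),
      ((2 : ℕ).choose j : ℝ) * rho ^ (2 - j) * bet ^ j * (lam ^ j)⁻¹ =
      2 * lam⁻¹ * (bet + rho * lam) ^ 2 := by
    simp [Finset.sum_range_succ]
    field_simp
    ring
  rw [hlim] at h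
  simpa using h

/-- The variables are centred, so the vanishing second cumulant is a vanishing squared `L²` norm. -/
lemma IsModel.tendstoInMeasure_scaledH (hlam : 0 < lam)
    (hm : IsModel P lam gam bet rho X Y Z) (hs : IsStrictlyStationary P X)
    (hX : ∀ p : ℕ, MemLp (X 0) p P) (hdeg : bet + rho * lam = 0) :
    TendstoInMeasure P (fun T : ℝ≥0 => scaledH P Y T) atTop (fun _ => 0) := by
  have hL := fun T => hm.memLp_scaledH hs hX T 2
  refine tendstoInMeasure_of_tendsto_eLpNorm (p := 2) two_ne_zero (fun T => (hL T).1)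
    aestronglyMeasurable_const ?_
  have h1 : Tendsto (fun T : ℝ≥0 => ∫ ω, scaledH P Y T ω ^ 2 ∂P) atTop (𝓝 0) := by
    have h := hm.tendsto_chi_two hlam hs hX
    rw [hdeg] at h
    have h' := (Complex.continuous_re.tendsto _).comp h
    simpa [Function.comp_def, hm.chi_two_eq hs hX] using h'
  have h2 : ∀ T, eLpNorm (scaledH P Y T - fun _ => 0) 2 P =
      ENNReal.ofReal (√(∫ ω, scaledH P Y T ω ^ 2 ∂P)) := by
    intro T
    have hz : (scaledH P Y T - fun _ => 0) = scaledH P Y T := by funext ω; simp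
    rw [hz, (hL T).eLpNorm_eq_integral_rpow_norm two_ne_zero (by norm_num), Real.sqrt_eq_rpow]
    simp
  simp only [h2]
  have h3 := ENNReal.tendsto_ofReal ((Real.continuous_sqrt.tendsto 0).comp h1)
  simpa using h3

lemma gaussianReal_ne_dirac {v : ℝ≥0} (hv : v ≠ 0) : gaussianReal 0 v ≠ Measure.dirac 0 := by
  intro h
  have h1 := variance_id_gaussianReal (μ := 0) (v := v)
  rw [h] at h1
  simp at h1
  exact hv (by exact_mod_cast h1.symm)

end Model

end LevyOU

theorem mainTheorem2 {Ω : Type*} [MeasurableSpace Ω] (P : Measure Ω) [IsProbabilityMeasure P]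
    (lam gam bet rho : ℝ) (hlam : 0 < lam)
    (X Y Z : ℝ≥0 → Ω → ℝ) (hmodel : LevyOU.IsModel P lam gam bet rho X Y Z)
    (hstat : LevyOU.IsStrictlyStationary P X)
    (F : Measure ℝ) (hF : P.map (X 0) = F) (hmom : ∀ p : ℝ≥0, MemLp id p F) :
    -- all the moments and cumulants involved exist
    (∀ T p : ℝ≥0, MemLp (Y T) p P) ∧
    (∀ r : ℕ, LevyOU.HasCumulant r F) ∧
    (∀ (r : ℕ) (T : ℝ≥0), 0 < T → LevyOU.HasCumulant r (P.map (LevyOU.scaledH P Y T))) ∧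
    -- the explicit formula
    (∀ (r : ℕ) (T : ℝ≥0), 2 ≤ r → 0 < T →
      LevyOU.chi P Y r T =
        (((T : ℝ) ^ (-((r : ℝ) - 2) / 2) *
          ((T : ℝ)⁻¹ * (bet * LevyOU.eta lam T) ^ r +
            lam * r * ∑ j ∈ Finset.range (r + 1),
              (r.choose j : ℝ) * rho ^ (r - j) * bet ^ j * LevyOU.calM lam T j) : ℝ) : ℂ) *
          LevyOU.cumulant r F) ∧
    -- the order of magnitude
    (∀ r : ℕ, 2 ≤ r →
      (fun T : ℝ≥0 => LevyOU.chi P Y r T) =O[atTop]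
        (fun T : ℝ≥0 => (T : ℝ) ^ (-((r : ℝ) - 2) / 2))) ∧
    -- the limit
    (∀ r : ℕ, 2 ≤ r →
      Tendsto (fun T : ℝ≥0 => (((T : ℝ) ^ (((r : ℝ) - 2) / 2) : ℝ) : ℂ) * LevyOU.chi P Y r T) atTop
        (𝓝 (((lam * r * ∑ j ∈ Finset.range (r + 1),
          (r.choose j : ℝ) * rho ^ (r - j) * bet ^ j * (lam ^ j)⁻¹ : ℝ) : ℂ) *
            LevyOU.cumulant r F))) ∧
    -- the limit of the variance
    Tendsto (fun T : ℝ≥0 => LevyOU.chi P Y 2 T) atTop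
      (𝓝 (((2 * lam⁻¹ * (bet + rho * lam) ^ 2 : ℝ) : ℂ) * LevyOU.cumulant 2 F)) ∧
    -- if `bet + rho * lam = 0`, the limit is degenerate
    (bet + rho * lam = 0 →
      Tendsto (fun T : ℝ≥0 => LevyOU.chi P Y 2 T) atTop (𝓝 0) ∧
      TendstoInMeasure P (fun T : ℝ≥0 => LevyOU.scaledH P Y T) atTop (fun _ => 0)) ∧
    -- so `bet + rho * lam ≠ 0` is necessary for a non-degenerate Gaussian limit
    ((∃ v : ℝ≥0, v ≠ 0 ∧
      TendstoInDistribution (fun T : ℝ≥0 => LevyOU.scaledH P Y T) atTop (id : ℝ → ℝ)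
        (fun _ => P) (gaussianReal 0 v)) → bet + rho * lam ≠ 0) := by
  subst hF
  have hX : ∀ p : ℕ, MemLp (X 0) p P := fun p =>
    (memLp_map_measure_iff aestronglyMeasurable_id (hmodel.measurable_X 0).aemeasurable).1
      (by simpa using hmom p)
  have : IsProbabilityMeasure (P.map (X 0)) :=
    Measure.isProbabilityMeasure_map (hmodel.measurable_X 0).aemeasurable
  refine ⟨fun T p => ?_, fun r => ?_, fun r T _ => ?_, fun r T hr hT => ?_, fun r hr => ?_,
    fun r hr => ?_, ?_, fun hdeg => ⟨?_, ?_⟩, ?_⟩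
  · obtain ⟨n, hn⟩ := exists_nat_ge p
    exact (hmodel.memLp_Y hstat hX T n).mono_exponent (by exact_mod_cast hn)
  · exact LevyOU.contDiffAt_logCharFun (fun k => by simpa using hmom k) r
  · have hL := hmodel.memLp_scaledH hstat hX T
    have hmeas := (hL 0).1.aemeasurable
    have := Measure.isProbabilityMeasure_map hmeas
    exact LevyOU.contDiffAt_logCharFun (LevyOU.memLp_id_map hmeas hL) r
  · exact hmodel.chi_eq hlam hstat hX hT hr
  · exact hmodel.isBigO_chi hlam hstat hX hr
  · exact hmodel.tendsto_scaled_chi hlam hstat hX hr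
  · exact hmodel.tendsto_chi_two hlam hstat hX
  · have h := hmodel.tendsto_chi_two hlam hstat hX
    rw [hdeg] at h
    simpa using h
  · exact hmodel.tendstoInMeasure_scaledH hlam hstat hX hdeg
  · rintro ⟨v, hv, hconv⟩ hdeg
    -- In the degenerate case the limit law is also the point mass at `0`; uniqueness of limits in
    -- distribution contradicts `v ≠ 0`.
    have h0 := (hmodel.tendstoInMeasure_scaledH hlam hstat hX hdeg).tendstoInDistribution
      fun T => (hmodel.memLp_scaledH hstat hX T 0).1.aemeasurable
    have heq := tendstoInDistribution_unique _ hconv h0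
    rw [Measure.map_id, Measure.map_const, measure_univ, one_smul] at heq
    exact LevyOU.gaussianReal_ne_dirac hv heq
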